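/- A production system has deterioration levels $\mathscr X=\{0,1,\dots,\xi\}$ (level $\xi$ means failure) and production rates $s\in[0,\bar s]$, $0<\bar s<\infty$. The deterioration function $f$ and the revenue function $r$ are continuous and increasing on $[0,\bar s]$ with $f(0)=0$ and $r(0)\le 0$; the maintenance cost function $c_m:\mathscr X\to[0,\infty)$ is increasing and convex. (Increasing and decreasing are meant weakly.) While rate $s$ is used, the deterioration level increases by one with intensity $\lambda f(s)$, where $\lambda\ge 0$ is the known base rate, and revenue accrues at rate $r(s)$; at level $\xi$ only $s=0$ is admissible. A policy chooses the rate in a non-anticipating way, as a measurable function of the elapsed time and of the epochs of past increments. Let $J^*_\lambda(x,t)$ be the supremum, over all admissible policies started from level $x$ with time $t\ge 0$ left until the planned maintenance, of the expected accumulated revenue (which accrues at rate $r(0)$ after a failure) minus the expected maintenance cost $c_m$ of the final level. Put $\Delta_\lambda(x,t)=J^*_\lambda(x,t)-J^*_\lambda(x+1,t)$ for $x<\xi$. Let $$A_\lambda(x,t)=\operatorname*{arg\,max}_{s\in[0,\bar s]}\big[r(s)-\lambda f(s)\Delta_\lambda(x,t)\big]\quad(x<\xi),\qquad A_\lambda(\xi,t)=\{0\}$$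 be the set of optimal production rates in state $(x,t)$. **Theorem.** (a) For all $\lambda\ge0$, $x\in\mathscr X$, $t\ge0$, the set $A_\lambda(x,t)$ has a largest and a smallest element. (b) If $s^*_\lambda(y,k)\in A_\lambda(y,k)$ for all $y\in\mathscr X$ and $k\ge0$, with $s^*_\lambda(y,\cdot)$ measurable for every $y$, then, for every $x\in\mathscr X$ and $t\ge0$, the policy that uses the rate $s^*_\lambda(y,k)$ whenever the level is $y$ and the time left is $k$ is admissible and optimal among all admissible policies started from $(x,t)$. (c) The optimal production rate is decreasing in the deterioration level $x$, in the time $t$ left until the planned maintenance, and in the base rate $\lambda$. That is, if $0\le\lambda\le\lambda'$, $x\le x'\le\xi$ and $0\le t\le t'$, then for all $a\in A_{\lambda'}(x',t')$ and $b\in A_\lambda(x,t)$ we have $\min(a,b)\in A_{\lambda'}(x',t')$ and $\max(a,b)\in A_\lambda(x,t)$; and both the largest and the smallest optimal production rate in state $(x',t')$ for base rate $\lambda'$ are at most the corresponding one in state $(x,t)$ for base rate $\lambda$. In particular, the optimal production rate is decreasing in $x$, $t$ and $\lambda$ wherever it is unique. -/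

import Mathlib

open Set MeasureTheory ProbabilityTheory

noncomputable section

/-- The data of the single-unit production system: failure level `xi`, largest production rate
`sbar`, deterioration function `f`, revenue function `r` (both on `[0, sbar]`) and the maintenance
cost function `c` (on the deterioration levels `{0, …, xi}`). Values outside these sets are
irrelevant. -/
structure ProductionSystem where
  xi : ℕ
  sbar : ℝ
  f : ℝ → ℝ
  r : ℝ → ℝ
  c : ℕ → ℝ
  sbar_pos : 0 < sbar
  f_continuous : ContinuousOn f (Icc 0 sbar)
  f_increasing : MonotoneOn f (Icc 0 sbar)
  f_zero : f 0 = 0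
  r_continuous : ContinuousOn r (Icc 0 sbar)
  r_increasing : MonotoneOn r (Icc 0 sbar)
  r_zero : r 0 ≤ 0
  c_nonneg : ∀ x ≤ xi, 0 ≤ c x
  c_increasing : MonotoneOn c (Iic xi)
  c_convex : ∀ x, x + 2 ≤ xi → c (x + 1) - c x ≤ c (x + 2) - c (x + 1)

namespace ProductionSystem

/-- A production policy on a horizon of length `t`: the rate used at elapsed time `w ∈ [0, t]`
(time to maintenance `t - w`) as a function of the list of the epochs of the past deterioration
increments, the most recent one first. -/
abbrev Policy := List ℝ → ℝ → ℝ

/-- The production rates that may be used at deterioration level `x`: all of `[0, sbar]` while the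
system works, only `0` (off) once it has failed. -/
def rates (S : ProductionSystem) (x : ℕ) : Set ℝ :=
  if x < S.xi then Icc 0 S.sbar else {0}

/-- Admissible policies from deterioration level `x` on a horizon of length `t`. A policy sees only
the epochs of past increments, hence it is non-anticipating. -/
structure IsAdmissible (S : ProductionSystem) (x : ℕ) (t : ℝ) (u : Policy) : Prop where
  measurable : ∀ n : ℕ,
    Measurable fun p : (Fin n → ℝ) × Icc (0 : ℝ) t => u (List.ofFn p.1) (p.2 : ℝ)
  mem_rates : ∀ h : List ℝ, ∀ w ∈ Icc (0 : ℝ) t, u h w ∈ S.rates (x + h.length)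

/-- The epoch of the next increment after the history `h`, when its (exponential) threshold is `e`:
the first `v` at which the intensity `lam * f (rate)`, accumulated since the last increment (since
time `0` if there was none), reaches `e`. If this does not happen up to the horizon `t`, the value
is `t + 1`, which stands for "not before the planned maintenance". -/
def nextEpoch (S : ProductionSystem) (lam t : ℝ) (u : Policy) (h : List ℝ) (e : ℝ) : ℝ :=
  sInf (insert (t + 1)
    {v : ℝ | h.headD 0 ≤ v ∧ v ≤ t ∧ e ≤ ∫ w in (h.headD 0)..v, lam * S.f (u h w)})

/-- The list of increment epochs, most recent first, produced by the thresholds `es`. -/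
def epochs (S : ProductionSystem) (lam t : ℝ) (u : Policy) (es : List ℝ) : List ℝ :=
  es.foldl (fun h e => S.nextEpoch lam t u h e :: h) []

/-- The increment epochs up to time `w`, most recent first. -/
def past (S : ProductionSystem) (lam t : ℝ) (u : Policy) (es : List ℝ) (w : ℝ) : List ℝ :=
  (S.epochs lam t u es).filter (fun v => decide (v ≤ w))

/-- The deterioration level at elapsed time `w` from initial level `x`. -/
def level (S : ProductionSystem) (lam : ℝ) (x : ℕ) (t : ℝ) (u : Policy) (es : List ℝ) (w : ℝ) :
    ℕ :=
  x + (S.past lam t u es w).length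

/-- The expected profit of the policy `u` from deterioration level `x` with time `t` left until the
planned maintenance and base rate `lam`: expected accumulated revenue minus expected maintenance
cost. The increments are driven by independent standard exponential thresholds, so that the
deterioration level is a counting process with intensity `lam * f (rate)`; there are `xi - x` of
them, since the system is off once it has failed. -/
def expectedProfit (S : ProductionSystem) (lam : ℝ) (x : ℕ) (t : ℝ) (u : Policy) : ℝ :=
  ∫ ω : Fin (S.xi - x) → ℝ,
    ((∫ w in (0 : ℝ)..t, S.r (u (S.past lam t u (List.ofFn ω) w) w))
      - S.c (S.level lam x t u (List.ofFn ω) t))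
    ∂(Measure.pi fun _ : Fin (S.xi - x) => expMeasure 1)

/-- The optimal expected profit `J*`. -/
def optimalProfit (S : ProductionSystem) (lam : ℝ) (x : ℕ) (t : ℝ) : ℝ :=
  ⨆ u : {u : Policy // S.IsAdmissible x t u}, S.expectedProfit lam x t u.1

/-- An admissible policy that no admissible policy improves. -/
def IsOptimalPolicy (S : ProductionSystem) (lam : ℝ) (x : ℕ) (t : ℝ) (u : Policy) : Prop :=
  S.IsAdmissible x t u ∧
    ∀ v : Policy, S.IsAdmissible x t v → S.expectedProfit lam x t v ≤ S.expectedProfit lam x t u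

/-- The marginal value `Δ` of less deterioration. -/
def marginalValue (S : ProductionSystem) (lam : ℝ) (x : ℕ) (t : ℝ) : ℝ :=
  S.optimalProfit lam x t - S.optimalProfit lam (x + 1) t

/-- The optimal production rates in state `(x, t)`: the maximizers of
`r s - lam * f s * Δ (x, t)` over the rates that may be used at level `x`
(at the failure level this is `{0}`). -/
def optimalRates (S : ProductionSystem) (lam : ℝ) (x : ℕ) (t : ℝ) : Set ℝ :=
  {s ∈ S.rates x | IsMaxOn (fun s => S.r s - lam * S.f s * S.marginalValue lam x t) (S.rates x) s}

/-- The largest optimal production rate. -/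
def largestOptimalRate (S : ProductionSystem) (lam : ℝ) (x : ℕ) (t : ℝ) : ℝ :=
  sSup (S.optimalRates lam x t)

/-- The smallest optimal production rate. -/
def smallestOptimalRate (S : ProductionSystem) (lam : ℝ) (x : ℕ) (t : ℝ) : ℝ :=
  sInf (S.optimalRates lam x t)

/-- The policy, started at level `x` with horizon `t`, that uses the rate `s y k` whenever the
deterioration level is `y` and the time left until the planned maintenance is `k`. -/
def feedback (x : ℕ) (t : ℝ) (s : ℕ → ℝ → ℝ) : Policy :=
  fun h w => s (x + h.length) (t - w)

end ProductionSystem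

/-- The strong (Veinott) set order on sets of reals. -/
def StrongSetLE (A B : Set ℝ) : Prop :=
  ∀ a ∈ A, ∀ b ∈ B, min a b ∈ A ∧ max a b ∈ B

end

/-!
The optimality equation `∂V(x, k)/∂k = max_s [r s - lam * f s * (V(x, k) - V(x + 1, k))]`, with
`V(x, 0) = -c x` and `V(xi, k) = r 0 * k - c xi`, determines everything.

* *Existence.* For `d ≥ 0` the Hamiltonian `max_s [r s - f s * d]` is bounded and Lipschitz in `d`.
  With `d` replaced by its positive part, Picard-Lindelöf solves the equation on any bounded time
  interval, one level at a time from `xi` downwards (`exists_isValueFunction`).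
* *Monotonicity.* A function that does not decrease where it is negative cannot become negative
  (`nonneg_of_deriv_nonneg_of_neg`). Applied to `Δ(x) = V(x) - V(x + 1)`, to `Δ(x + 1) - Δ(x)` and
  to the difference of `lam * Δ(x)` for two base rates, by induction on the distance from failure,
  this gives `Δ ≥ 0` (so the truncation is inactive) and that `lam * Δ` increases in the level, the
  time left and the base rate. As `f` is increasing, the maximizers of `r s - f s * d` decrease in
  `d` in the strong set order (`strongSetLE_maximizers`), so they decrease in all three variables.
* *Verification.* By induction on the number of increments left, every admissible policy earns at
  most `V`, and exactly `V` if its rates are maximizers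
  (`IsValueFunction.integral_stagedProfit_le`).
  The inductive step is the identity `hittingTime.integral_stage` for the time until the next
  increment, which combines the fundamental theorem of calculus for `V` with the density
  `φ * exp (-∫ φ)` of the epoch of an increment with intensity `φ`. Feedback through the largest
  maximizers is admissible, because they are monotone in time and hence measurable, so `V` is the
  optimal profit (`IsValueFunction.optimalProfit_eq`).
-/

noncomputable section

namespace ProductionSystem

variable (S : ProductionSystem)

/-! ### The Hamiltonian -/

lemma zero_mem_Icc : (0 : ℝ) ∈ Icc 0 S.sbar := ⟨le_rfl, S.sbar_pos.le⟩

lemma sbar_mem_Icc : S.sbar ∈ Icc 0 S.sbar := ⟨S.sbar_pos.le, le_rfl⟩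

lemma f_nonneg {s : ℝ} (hs : s ∈ Icc 0 S.sbar) : 0 ≤ S.f s :=
  S.f_zero ▸ S.f_increasing S.zero_mem_Icc hs hs.1

/-- The maximal net revenue rate `max_s [r s - f s * d]` when an increment of the accumulated
deterioration costs `d`. The cost enters through its positive part: marginal values turn out to be
nonnegative, and the truncation makes the Hamiltonian bounded, so that the optimality equation has
a solution on every bounded time interval. -/
def hamiltonian (d : ℝ) : ℝ :=
  sSup ((fun s => S.r s - S.f s * max d 0) '' Icc 0 S.sbar)

lemma continuousOn_netRevenue (d : ℝ) :
    ContinuousOn (fun s => S.r s - S.f s * d) (Icc 0 S.sbar) :=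
  S.r_continuous.sub (S.f_continuous.mul continuousOn_const)

lemma le_hamiltonian (d : ℝ) {s : ℝ} (hs : s ∈ Icc 0 S.sbar) :
    S.r s - S.f s * max d 0 ≤ S.hamiltonian d :=
  le_csSup (isCompact_Icc.image_of_continuousOn (S.continuousOn_netRevenue _)).bddAbove
    (mem_image_of_mem _ hs)

lemma exists_hamiltonian_eq (d : ℝ) :
    ∃ s ∈ Icc 0 S.sbar, S.hamiltonian d = S.r s - S.f s * max d 0 :=
  isCompact_Icc.exists_sSup_image_eq ⟨0, S.zero_mem_Icc⟩ (S.continuousOn_netRevenue _)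

lemma hamiltonian_antitone : Antitone S.hamiltonian := by
  intro d e hde
  obtain ⟨s, hs, h⟩ := S.exists_hamiltonian_eq e
  rw [h]
  refine le_trans ?_ (S.le_hamiltonian d hs)
  have := mul_le_mul_of_nonneg_left (max_le_max_right 0 hde) (S.f_nonneg hs)
  linarith

lemma r_zero_le_hamiltonian (d : ℝ) : S.r 0 ≤ S.hamiltonian d := by
  simpa [S.f_zero] using S.le_hamiltonian d S.zero_mem_Icc

lemma hamiltonian_le (d : ℝ) : S.hamiltonian d ≤ S.r S.sbar := by
  obtain ⟨s, hs, h⟩ := S.exists_hamiltonian_eq d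
  have h1 := S.r_increasing hs S.sbar_mem_Icc hs.2
  have h2 := mul_nonneg (S.f_nonneg hs) (le_max_right d 0)
  linarith

lemma hamiltonian_sub_le (d e : ℝ) :
    S.hamiltonian d - S.hamiltonian e ≤ S.f S.sbar * |d - e| := by
  obtain ⟨s, hs, h⟩ := S.exists_hamiltonian_eq d
  have h1 := S.le_hamiltonian e hs
  have h2 : max e 0 - max d 0 ≤ |d - e| := by
    have := abs_max_sub_max_le_abs e d 0
    rw [abs_sub_comm d e]
    exact (le_abs_self _).trans this
  have h3 := mul_le_mul_of_nonneg_left h2 (S.f_nonneg hs)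
  have h4 := mul_le_mul_of_nonneg_right (S.f_increasing hs S.sbar_mem_Icc hs.2) (abs_nonneg (d - e))
  linarith

lemma lipschitzWith_hamiltonian : LipschitzWith (S.f S.sbar).toNNReal S.hamiltonian := by
  refine LipschitzWith.of_dist_le_mul fun d e => ?_
  rw [Real.coe_toNNReal _ (S.f_nonneg S.sbar_mem_Icc), Real.dist_eq, Real.dist_eq, abs_le]
  have h1 := S.hamiltonian_sub_le d e
  have h2 := S.hamiltonian_sub_le e d
  rw [abs_sub_comm e d] at h2
  constructor <;> linarith

/-! ### The optimality equation -/

/-- The right-hand side of the optimality equation: the growth rate of the candidate `V` for the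
optimal profit at level `x` with time `k` left. -/
def growth (lam : ℝ) (V : ℕ → ℝ → ℝ) (x : ℕ) (k : ℝ) : ℝ :=
  if x < S.xi then S.hamiltonian (lam * (V x k - V (x + 1) k)) else S.r 0

/-- `V` solves the optimality equation on the time interval `[0, T]`, with terminal values the
negative maintenance costs. Only levels up to `xi` and times in `[0, T]` matter; continuity is
required everywhere so that no measurability question arises outside. -/
structure IsValueFunction (lam T : ℝ) (V : ℕ → ℝ → ℝ) : Prop where
  continuous : ∀ x, Continuous (V x)
  zero : ∀ x ≤ S.xi, V x 0 = - S.c x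
  failed : ∀ k ∈ Icc 0 T, V S.xi k = S.r 0 * k - S.c S.xi
  deriv : ∀ x ≤ S.xi, ∀ k ∈ Icc 0 T, HasDerivWithinAt (V x) (S.growth lam V x k) (Icc 0 T) k

/-- One level of the optimality equation, solved by Picard-Lindelöf; boundedness of the Hamiltonian
makes the solution reach the end of any time interval. -/
lemma exists_solution (lam : ℝ) {T : ℝ} (hT : 0 ≤ T) {g : ℝ → ℝ} (hg : Continuous g) (v₀ : ℝ) :
    ∃ v : ℝ → ℝ, Continuous v ∧ v 0 = v₀ ∧ ∀ k ∈ Icc 0 T,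
      HasDerivWithinAt v (S.hamiltonian (lam * (v k - g k))) (Icc 0 T) k := by
  have hLip : ∀ t : ℝ, LipschitzWith ((S.f S.sbar).toNNReal * (‖lam‖₊ * (1 + 0)))
      (fun v => S.hamiltonian (lam * (v - g t))) := fun t =>
    S.lipschitzWith_hamiltonian.comp
      ((lipschitzWith_smul lam).comp (LipschitzWith.id.sub (LipschitzWith.const (g t))))
  have hcont : Continuous S.hamiltonian := S.lipschitzWith_hamiltonian.continuous
  set M : NNReal := (max |S.r 0| |S.r S.sbar|).toNNReal with hM
  have hM' : (M : ℝ) = max |S.r 0| |S.r S.sbar| :=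
    Real.coe_toNNReal _ ((abs_nonneg _).trans (le_max_left _ _))
  have hPL : IsPicardLindelof (fun t v => S.hamiltonian (lam * (v - g t)))
      (⟨0, le_rfl, hT⟩ : Icc (0 : ℝ) T) v₀ (M * T.toNNReal) 0 M
      ((S.f S.sbar).toNNReal * (‖lam‖₊ * (1 + 0))) := by
    refine ⟨fun t _ => (hLip t).lipschitzOnWith, fun v _ => ?_, fun t _ v _ => ?_, ?_⟩
    · exact (hcont.comp (by fun_prop)).continuousOn
    · rw [hM', Real.norm_eq_abs]
      exact abs_le_max_abs_abs (S.r_zero_le_hamiltonian _) (S.hamiltonian_le _)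
    · simp [hT]
  obtain ⟨v, hv0, hv⟩ := hPL.exists_eq_forall_mem_Icc_hasDerivWithinAt₀
  have hvc : ContinuousOn v (Icc 0 T) := fun k hk => (hv k hk).continuousWithinAt
  have heq : ∀ k ∈ Icc 0 T, IccExtend hT (domRestrict (Icc 0 T) v) k = v k := fun k hk => by
    rw [IccExtend_of_mem _ _ hk]; rfl
  refine ⟨IccExtend hT (domRestrict (Icc 0 T) v), hvc.domRestrict.Icc_extend', ?_, fun k hk => ?_⟩
  · rw [heq 0 ⟨le_rfl, hT⟩]; exact hv0
  · rw [heq k hk]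
    exact (hv k hk).congr heq (heq k hk)

lemma exists_isValueFunction (lam : ℝ) {T : ℝ} (hT : 0 ≤ T) :
    ∃ V, S.IsValueFunction lam T V := by
  choose step hstep using fun (g : {g : ℝ → ℝ // Continuous g}) (v₀ : ℝ) =>
    S.exists_solution lam hT g.2 v₀
  -- `W n` is the value function with `n` increments left until failure
  let W : ℕ → {g : ℝ → ℝ // Continuous g} := fun n =>
    Nat.rec ⟨fun k => S.r 0 * k - S.c S.xi, by fun_prop⟩
      (fun n g => ⟨step g (-S.c (S.xi - (n + 1))), (hstep _ _).1⟩) n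
  have hW : ∀ n, (W (n + 1)).1 = step (W n) (-S.c (S.xi - (n + 1))) := fun n => rfl
  refine ⟨fun x => (W (S.xi - x)).1, fun x => (W _).2, fun x hx => ?_, fun k _ => ?_,
    fun x hx k hk => ?_⟩
  · rcases hx.eq_or_lt with rfl | hx
    · simp [W]
    · obtain ⟨n, hn⟩ : ∃ n, S.xi - x = n + 1 := ⟨S.xi - x - 1, by omega⟩
      have hx' : S.xi - (n + 1) = x := by omega
      simp only [hn, hW, hx']
      exact (hstep _ _).2.1
  · simp [W]
  · rcases hx.eq_or_lt with rfl | hx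
    · simpa [W, growth] using (((hasDerivAt_id k).const_mul (S.r 0)).sub_const
        (S.c S.xi)).hasDerivWithinAt
    · obtain ⟨n, hn⟩ : ∃ n, S.xi - x = n + 1 := ⟨S.xi - x - 1, by omega⟩
      have hn' : S.xi - (x + 1) = n := by omega
      simp only [growth, if_pos hx, hn, hn', hW]
      exact (hstep _ _).2.2 k hk

/-- A function that starts nonnegative and does not decrease where it is negative stays
nonnegative. -/
lemma nonneg_of_deriv_nonneg_of_neg {T : ℝ} {d d' : ℝ → ℝ}
    (hd : ∀ k ∈ Icc 0 T, HasDerivWithinAt d (d' k) (Icc 0 T) k) (h0 : 0 ≤ d 0)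
    (h : ∀ k ∈ Icc 0 T, d k < 0 → 0 ≤ d' k) {k : ℝ} (hk : k ∈ Icc 0 T) : 0 ≤ d k := by
  refine le_of_forall_pos_le_add fun ε hε => ?_
  have hT : 0 ≤ T := hk.1.trans hk.2
  -- compare `-d` with the strictly increasing barrier `ε / (1 + T) * (1 + k)`
  set η := ε / (1 + T) with hη
  have hη0 : 0 < η := by positivity
  have key := image_le_of_deriv_right_lt_deriv_boundary (f := fun k => - d k)
    (f' := fun k => - d' k) (a := 0) (b := T) (B := fun k => η * (1 + k)) (B' := fun _ => η)
    (fun k hk => (hd k hk).continuousWithinAt.neg)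
    (fun k hk => ((hd k (Ico_subset_Icc_self hk)).mono_of_mem_nhdsWithin
      (Icc_mem_nhdsGE_of_mem hk)).neg) (by simp; linarith)
    (fun k => by simpa using ((hasDerivAt_id k).const_add 1).const_mul η)
    (fun k hk hkB => by
      have hneg : d k < 0 := by
        have : 0 < η * (1 + k) := mul_pos hη0 (by linarith [hk.1])
        linarith
      linarith [h k (Ico_subset_Icc_self hk) hneg]) hk
  have h1 : η * (1 + k) ≤ ε := by
    calc η * (1 + k) ≤ η * (1 + T) := by gcongr; exact hk.2
      _ = ε := by rw [hη]; field_simp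
  linarith

namespace IsValueFunction

variable {S} {lam T : ℝ} {V : ℕ → ℝ → ℝ}

lemma hasDerivWithinAt_sub (hV : S.IsValueFunction lam T V) {x : ℕ} (hx : x < S.xi) {k : ℝ}
    (hk : k ∈ Icc 0 T) :
    HasDerivWithinAt (fun k => V x k - V (x + 1) k)
      (S.growth lam V x k - S.growth lam V (x + 1) k) (Icc 0 T) k :=
  (hV.deriv x hx.le k hk).sub (hV.deriv (x + 1) hx k hk)

lemma r_zero_le_growth (x : ℕ) (k : ℝ) : S.r 0 ≤ S.growth lam V x k := by
  unfold growth; split_ifs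
  exacts [S.r_zero_le_hamiltonian _, le_rfl]

lemma growth_le_hamiltonian_zero (x : ℕ) (k : ℝ) : S.growth lam V x k ≤ S.hamiltonian 0 := by
  unfold growth; split_ifs
  · obtain ⟨s, hs, h⟩ := S.exists_hamiltonian_eq (lam * (V x k - V (x + 1) k))
    have h1 := S.le_hamiltonian 0 hs
    have h2 := mul_nonneg (S.f_nonneg hs) (le_max_right (lam * (V x k - V (x + 1) k)) 0)
    simp at h1
    linarith
  · exact S.r_zero_le_hamiltonian _

/-- Less deterioration is worth more. -/
lemma sub_nonneg (hV : S.IsValueFunction lam T V) (hlam : 0 ≤ lam) {x : ℕ} (hx : x < S.xi) {k : ℝ}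
    (hk : k ∈ Icc 0 T) : 0 ≤ V x k - V (x + 1) k := by
  refine nonneg_of_deriv_nonneg_of_neg (fun k hk => hV.hasDerivWithinAt_sub hx hk) ?_
    (fun k hk hneg => ?_) hk
  · have := S.c_increasing (mem_Iic.2 hx.le) (mem_Iic.2 hx) (Nat.le_succ x)
    rw [hV.zero x hx.le, hV.zero (x + 1) hx]
    linarith
  · have h1 : S.hamiltonian 0 ≤ S.growth lam V x k := by
      rw [growth, if_pos hx]
      exact S.hamiltonian_antitone (mul_nonpos_of_nonneg_of_nonpos hlam hneg.le)
    linarith [growth_le_hamiltonian_zero (S := S) (lam := lam) (V := V) (x + 1) k]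

/-- Marginal values increase with the deterioration level, so the value grows more slowly at higher
levels. -/
lemma growth_antitone_step (hV : S.IsValueFunction lam T V) (hlam : 0 ≤ lam) (n : ℕ) :
    ∀ x, x + 1 + n = S.xi → ∀ k ∈ Icc 0 T,
      S.growth lam V (x + 1) k ≤ S.growth lam V x k ∧
      (x + 2 ≤ S.xi → V x k - V (x + 1) k ≤ V (x + 1) k - V (x + 2) k) := by
  induction n with
  | zero =>
    intro x hx k _
    refine ⟨?_, fun h => by omega⟩
    rw [growth, if_neg (by omega)]
    exact r_zero_le_growth x k
  | succ n ih =>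
    intro x hx k hk
    have hx0 : x < S.xi := by omega
    have hx1 : x + 1 < S.xi := by omega
    have hanti : ∀ {k}, V x k - V (x + 1) k ≤ V (x + 1) k - V (x + 2) k →
        S.growth lam V (x + 1) k ≤ S.growth lam V x k := fun h => by
      rw [growth, growth, if_pos hx0, if_pos hx1]
      exact S.hamiltonian_antitone (mul_le_mul_of_nonneg_left h hlam)
    have hanti' : ∀ {k}, V (x + 1) k - V (x + 2) k ≤ V x k - V (x + 1) k →
        S.growth lam V x k ≤ S.growth lam V (x + 1) k := fun h => by
      rw [growth, growth, if_pos hx0, if_pos hx1]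
      exact S.hamiltonian_antitone (mul_le_mul_of_nonneg_left h hlam)
    -- where the inequality fails, neither level `x` nor level `x + 2` grows faster than `x + 1`
    have hE : 0 ≤ (V (x + 1) k - V (x + 2) k) - (V x k - V (x + 1) k) := by
      refine nonneg_of_deriv_nonneg_of_neg
        (fun k hk => (hV.hasDerivWithinAt_sub hx1 hk).sub (hV.hasDerivWithinAt_sub hx0 hk)) ?_
        (fun k hk hneg => ?_) hk
      · have := S.c_convex x hx1
        simp only [Pi.sub_apply]
        rw [hV.zero x hx0.le, hV.zero (x + 1) hx1.le, hV.zero (x + 1 + 1) hx1]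
        linarith
      · simp only [Pi.sub_apply] at hneg
        have h1 := hanti' (k := k) (by linarith)
        have h2 := (ih (x + 1) (by omega) k hk).1
        linarith
    exact ⟨hanti (by linarith), fun _ => by linarith⟩

lemma sub_le_sub_succ (hV : S.IsValueFunction lam T V) (hlam : 0 ≤ lam) {x x' : ℕ} (hxx : x ≤ x')
    (hx' : x' < S.xi) {k : ℝ} (hk : k ∈ Icc 0 T) :
    V x k - V (x + 1) k ≤ V x' k - V (x' + 1) k := by
  induction x', hxx using Nat.le_induction with
  | base => exact le_rfl
  | succ y hy ih =>
    exact (ih (by omega)).trans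
      ((hV.growth_antitone_step hlam (S.xi - (y + 1)) y (by omega) k hk).2 (by omega))

lemma monotoneOn_sub (hV : S.IsValueFunction lam T V) (hlam : 0 ≤ lam) {x : ℕ} (hx : x < S.xi) :
    MonotoneOn (fun k => V x k - V (x + 1) k) (Icc 0 T) := by
  refine monotoneOn_of_hasDerivWithinAt_nonneg (convex_Icc 0 T)
    (fun k hk => (hV.hasDerivWithinAt_sub hx hk).continuousWithinAt)
    (fun k hk => (hV.hasDerivWithinAt_sub hx (interior_subset hk)).mono interior_subset)
    fun k hk => ?_
  linarith [(hV.growth_antitone_step hlam (S.xi - (x + 1)) x (by omega) k (interior_subset hk)).1]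

/-- The marginal value per unit of intensity, `lam * Δ`, increases with the base rate. -/
lemma mul_sub_le_mul_sub {lam' : ℝ} {V' : ℕ → ℝ → ℝ} (hV : S.IsValueFunction lam T V)
    (hV' : S.IsValueFunction lam' T V') (hlam : 0 ≤ lam) (hll : lam ≤ lam') (n : ℕ) :
    ∀ x, x + n = S.xi → ∀ k ∈ Icc 0 T,
      S.growth lam' V' x k ≤ S.growth lam V x k ∧
      (x < S.xi → lam * (V x k - V (x + 1) k) ≤ lam' * (V' x k - V' (x + 1) k)) := by
  induction n with
  | zero =>
    intro x hx k _
    refine ⟨?_, fun h => by omega⟩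
    rw [growth, growth, if_neg (by omega), if_neg (by omega)]
  | succ n ih =>
    intro x hx k hk
    have hx0 : x < S.xi := by omega
    have hD : 0 ≤ lam' * (V' x k - V' (x + 1) k) - lam * (V x k - V (x + 1) k) := by
      refine nonneg_of_deriv_nonneg_of_neg
        (fun k hk => ((hV'.hasDerivWithinAt_sub hx0 hk).const_mul lam').sub
          ((hV.hasDerivWithinAt_sub hx0 hk).const_mul lam)) ?_ (fun k hk hneg => ?_) hk
      · have h1 := S.c_increasing (mem_Iic.2 hx0.le) (mem_Iic.2 hx0) (Nat.le_succ x)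
        simp only [Pi.sub_apply]
        rw [hV.zero x hx0.le, hV.zero (x + 1) hx0, hV'.zero x hx0.le, hV'.zero (x + 1) hx0]
        nlinarith
      · simp only [Pi.sub_apply] at hneg
        have h1 : S.growth lam V x k ≤ S.growth lam' V' x k := by
          rw [growth, growth, if_pos hx0, if_pos hx0]
          exact S.hamiltonian_antitone (by linarith)
        have h2 := (ih (x + 1) (by omega) k hk).1
        have h3 := (hV'.growth_antitone_step (hlam.trans hll) n x (by omega) k hk).1
        have h4 := mul_le_mul_of_nonneg_right hll (_root_.sub_nonneg.2 h3)
        have h5 := mul_le_mul_of_nonneg_left h2 hlam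
        have h6 := mul_le_mul_of_nonneg_left h1 hlam
        linarith
    refine ⟨?_, fun _ => by linarith⟩
    rw [growth, growth, if_pos hx0, if_pos hx0]
    exact S.hamiltonian_antitone (by linarith)

end IsValueFunction

end ProductionSystem

/-! ### Monotone comparative statics -/

lemma StrongSetLE.isGreatest_le {A B : Set ℝ} (h : StrongSetLE A B) {a b : ℝ}
    (ha : IsGreatest A a) (hb : IsGreatest B b) : a ≤ b :=
  (le_max_left a b).trans (hb.2 (h a ha.1 b hb.1).2)

lemma StrongSetLE.isLeast_le {A B : Set ℝ} (h : StrongSetLE A B) {a b : ℝ}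
    (ha : IsLeast A a) (hb : IsLeast B b) : a ≤ b :=
  (ha.2 (h a ha.1 b hb.1).1).trans (min_le_right a b)

namespace ProductionSystem

variable (S : ProductionSystem)

/-- The maximizers of `r s - f s * d` over all rates. -/
def maximizers (d : ℝ) : Set ℝ :=
  {s ∈ Icc 0 S.sbar | IsMaxOn (fun s => S.r s - S.f s * d) (Icc 0 S.sbar) s}

lemma isCompact_maximizers (d : ℝ) : IsCompact (S.maximizers d) := by
  obtain ⟨m, hm, hmax⟩ := isCompact_Icc.exists_isMaxOn ⟨0, S.zero_mem_Icc⟩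
    (S.continuousOn_netRevenue d)
  have : S.maximizers d =
      Icc 0 S.sbar ∩ (fun s => S.r s - S.f s * d) ⁻¹' Ici (S.r m - S.f m * d) := by
    ext s
    exact ⟨fun h => ⟨h.1, h.2 hm⟩, fun h =>
      ⟨h.1, isMaxOn_iff.2 fun y hy => (isMaxOn_iff.1 hmax y hy).trans h.2⟩⟩
  rw [this]
  exact isCompact_Icc.of_isClosed_subset
    ((S.continuousOn_netRevenue d).preimage_isClosed_of_isClosed isClosed_Icc isClosed_Ici)
    inter_subset_left

lemma maximizers_nonempty (d : ℝ) : (S.maximizers d).Nonempty := by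
  obtain ⟨m, hm, hmax⟩ := isCompact_Icc.exists_isMaxOn ⟨0, S.zero_mem_Icc⟩
    (S.continuousOn_netRevenue d)
  exact ⟨m, hm, hmax⟩

/-- The maximizers decrease with the cost of deterioration: `r s - f s * d` has decreasing
differences in `(s, d)`. -/
lemma strongSetLE_maximizers {d d' : ℝ} (h : d ≤ d') :
    StrongSetLE (S.maximizers d') (S.maximizers d) := by
  intro a ha b hb
  rcases le_total a b with hab | hab
  · rw [min_eq_left hab, max_eq_right hab]
    exact ⟨ha, hb⟩
  · rw [min_eq_right hab, max_eq_left hab]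
    have h1 : S.r b - S.f b * d' ≤ S.r a - S.f a * d' := ha.2 hb.1
    have h2 : S.r a - S.f a * d ≤ S.r b - S.f b * d := hb.2 ha.1
    have h3 := mul_le_mul_of_nonneg_left h (_root_.sub_nonneg.2 (S.f_increasing hb.1 ha.1 hab))
    exact ⟨⟨hb.1, isMaxOn_iff.2 fun y hy => (isMaxOn_iff.1 ha.2 y hy).trans (by linarith)⟩,
      ⟨ha.1, isMaxOn_iff.2 fun y hy => (isMaxOn_iff.1 hb.2 y hy).trans (by linarith)⟩⟩

lemma hamiltonian_eq_of_mem_maximizers {d s : ℝ} (hd : 0 ≤ d) (hs : s ∈ S.maximizers d) :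
    S.hamiltonian d = S.r s - S.f s * d := by
  obtain ⟨m, hm, h⟩ := S.exists_hamiltonian_eq d
  have h1 := S.le_hamiltonian d hs.1
  have h2 : S.r m - S.f m * d ≤ S.r s - S.f s * d := hs.2 hm
  rw [max_eq_left hd] at h h1
  linarith

end ProductionSystem

/-! ### The epoch of a single increment -/

/-- The first `v ∈ [a, t]` at which the intensity `φ`, accumulated since time `a`, reaches the
threshold `e`, and `t + 1` if there is none. -/
def hittingTime (φ : ℝ → ℝ) (a t e : ℝ) : ℝ :=
  sInf (insert (t + 1) {v : ℝ | a ≤ v ∧ v ≤ t ∧ e ≤ ∫ w in a..v, φ w})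

namespace hittingTime

instance : IsProbabilityMeasure (expMeasure 1) := isProbabilityMeasure_expMeasure one_pos

variable {φ : ℝ → ℝ} {a t : ℝ}

lemma integral_mono (hφ : ∀ a b, IntervalIntegrable φ volume a b) (h0 : ∀ w, 0 ≤ φ w) (a : ℝ) :
    Monotone fun v => ∫ w in a..v, φ w := by
  intro v v' hv
  have h1 := intervalIntegral.integral_add_adjacent_intervals (hφ a v) (hφ v v')
  have h2 := intervalIntegral.integral_nonneg (μ := volume) hv fun w _ => h0 w
  simp only
  linarith

lemma eq_or_mem (hφ : ∀ a b, IntervalIntegrable φ volume a b) (e : ℝ) :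
    hittingTime φ a t e = t + 1 ∨ a ≤ hittingTime φ a t e ∧ hittingTime φ a t e ≤ t ∧
      e ≤ ∫ w in a..hittingTime φ a t e, φ w := by
  have hcl : IsClosed (insert (t + 1) {v : ℝ | a ≤ v ∧ v ≤ t ∧ e ≤ ∫ w in a..v, φ w}) := by
    rw [insert_eq]
    refine isClosed_singleton.union ?_
    exact (isClosed_le continuous_const continuous_id).inter
      ((isClosed_le continuous_id continuous_const).inter
        (isClosed_le continuous_const (intervalIntegral.continuous_primitive hφ a)))
  have hbdd : BddBelow (insert (t + 1) {v : ℝ | a ≤ v ∧ v ≤ t ∧ e ≤ ∫ w in a..v, φ w}) :=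
    BddBelow.insert _ ⟨a, fun v hv => hv.1⟩
  exact hcl.csInf_mem (insert_nonempty _ _) hbdd

lemma le_iff (hφ : ∀ a b, IntervalIntegrable φ volume a b) (h0 : ∀ w, 0 ≤ φ w) (e v : ℝ) :
    hittingTime φ a t e ≤ v ↔
      t + 1 ≤ v ∨ a ≤ min v t ∧ e ≤ ∫ w in a..min v t, φ w := by
  have hbdd : BddBelow (insert (t + 1) {v : ℝ | a ≤ v ∧ v ≤ t ∧ e ≤ ∫ w in a..v, φ w}) :=
    BddBelow.insert _ ⟨a, fun v hv => hv.1⟩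
  constructor
  · intro h
    rcases eq_or_mem (a := a) (t := t) hφ e with h1 | ⟨h1, h2, h3⟩
    · exact Or.inl (h1 ▸ h)
    · have h4 := le_min h h2
      exact Or.inr ⟨h1.trans h4, h3.trans (integral_mono hφ h0 a h4)⟩
  · rintro (h | ⟨h1, h2⟩)
    · exact (csInf_le hbdd (mem_insert _ _)).trans h
    · exact (csInf_le hbdd (mem_insert_of_mem _ ⟨h1, min_le_right _ _, h2⟩)).trans (min_le_left _ _)

lemma le_iff_of_mem (hφ : ∀ a b, IntervalIntegrable φ volume a b) (h0 : ∀ w, 0 ≤ φ w) {e v : ℝ}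
    (hv : v ∈ Icc a t) : hittingTime φ a t e ≤ v ↔ e ≤ ∫ w in a..v, φ w := by
  rw [le_iff hφ h0, min_eq_left hv.2]
  have : ¬ t + 1 ≤ v := by linarith [hv.2]
  simp [this, hv.1]

lemma le_self (hφ : ∀ a b, IntervalIntegrable φ volume a b) (hat : a ≤ t) (e : ℝ) :
    a ≤ hittingTime φ a t e := by
  rcases eq_or_mem (a := a) (t := t) hφ e with h1 | ⟨h1, -⟩
  · rw [h1]; linarith
  · exact h1

lemma measurable (hφ : ∀ a b, IntervalIntegrable φ volume a b) (h0 : ∀ w, 0 ≤ φ w) :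
    Measurable (hittingTime φ a t) := by
  refine measurable_of_Iic fun v => ?_
  have : hittingTime φ a t ⁻¹' Iic v =
      {_e | t + 1 ≤ v} ∪ ({_e | a ≤ min v t} ∩ Iic (∫ w in a..min v t, φ w)) := by
    ext e; exact le_iff hφ h0 e v
  rw [this]
  exact (MeasurableSet.const _).union ((MeasurableSet.const _).inter measurableSet_Iic)

lemma expMeasure_Iic {c : ℝ} (hc : 0 ≤ c) :
    expMeasure 1 (Iic c) = ENNReal.ofReal (1 - Real.exp (-c)) := by
  rw [← ofReal_cdf, cdf_expMeasure_eq one_pos, if_pos hc, one_mul]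

lemma expMeasure_real_Ioi {c : ℝ} (hc : 0 ≤ c) :
    (expMeasure 1).real (Ioi c) = Real.exp (-c) := by
  rw [← compl_Iic, probReal_compl_eq_one_sub measurableSet_Iic, measureReal_def, expMeasure_Iic hc,
    ENNReal.toReal_ofReal]
  · ring
  · simpa using hc

/-- The density `φ * exp (-∫ φ)` of the epoch integrates to the distribution function: the
function `exp (-∫ φ)` is Lipschitz, hence absolutely continuous. -/
lemma integral_density {C : ℝ} (hφ : ∀ a b, IntervalIntegrable φ volume a b) (h0 : ∀ w, 0 ≤ φ w)
    (hC : ∀ w, φ w ≤ C) {v : ℝ} (hv : a ≤ v) :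
    ∫ w in a..v, φ w * Real.exp (-∫ u in a..w, φ u) = 1 - Real.exp (-∫ u in a..v, φ u) := by
  set Φ : ℝ → ℝ := fun w => ∫ u in a..w, φ u with hΦ
  -- `exp (-x)` is 1-Lipschitz on `[0, ∞)`
  have hexp : ∀ x y : ℝ, 0 ≤ x → x ≤ y → Real.exp (-x) - Real.exp (-y) ≤ y - x := by
    intro x y hx hxy
    have h1 := Real.add_one_le_exp (-(y - x))
    have h2 : Real.exp (-y) = Real.exp (-x) * Real.exp (-(y - x)) := by
      rw [← Real.exp_add]; ring_nf
    have h3 : Real.exp (-x) ≤ 1 := Real.exp_le_one_iff.2 (by linarith)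
    have h4 := Real.exp_pos (-x)
    rw [h2]
    nlinarith
  have hmono := integral_mono hφ h0 a
  have hC0 : 0 ≤ C := (h0 0).trans (hC 0)
  have hΦL : ∀ x y : ℝ, x ≤ y → Φ y - Φ x ≤ C * (y - x) := by
    intro x y hxy
    rw [hΦ]
    simp only
    rw [intervalIntegral.integral_interval_sub_left (hφ _ _) (hφ _ _)]
    calc ∫ w in x..y, φ w ≤ ∫ w in x..y, C :=
          intervalIntegral.integral_mono_on hxy (hφ _ _) (by simp) fun w _ => hC w
      _ = C * (y - x) := by simp [mul_comm]
  have hLip : LipschitzOnWith C.toNNReal (fun w => - Real.exp (-Φ w)) (uIcc a v) := by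
    rw [uIcc_of_le hv]
    refine LipschitzOnWith.of_dist_le_mul fun x hx y hy => ?_
    rw [Real.coe_toNNReal _ hC0]
    wlog hxy : x ≤ y generalizing x y
    · rw [dist_comm, dist_comm x y]; exact this y hy x hx (le_of_not_ge hxy)
    have hx0 : 0 ≤ Φ x := by simpa [hΦ] using hmono hx.1
    have h1 := hmono hxy
    have h2 := Real.exp_le_exp.2 (neg_le_neg h1)
    rw [dist_comm, dist_comm x y, Real.dist_eq, Real.dist_eq, abs_of_nonneg (by linarith),
      abs_of_nonneg (by linarith)]
    linarith [hexp _ _ hx0 h1, hΦL x y hxy]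
  have hFTC := hLip.absolutelyContinuousOnInterval.integral_deriv_eq_sub
  have hcongr : ∫ w in a..v, φ w * Real.exp (-Φ w) =
      ∫ w in a..v, deriv (fun w => - Real.exp (-Φ w)) w := by
    refine intervalIntegral.integral_congr_ae ?_
    filter_upwards [(hφ a v).ae_hasDerivAt_integral] with w hw hwm
    have hd := hw (uIoc_subset_uIcc hwm) a left_mem_uIcc
    rw [(hd.fun_neg.exp.fun_neg).deriv]
    ring
  rw [hcongr, hFTC]
  simp [hΦ]
  ring

/-- The distribution of the epoch on `[a, t]`. -/
lemma map_eq_withDensity {C : ℝ} (hφ : ∀ a b, IntervalIntegrable φ volume a b)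
    (h0 : ∀ w, 0 ≤ φ w) (hC : ∀ w, φ w ≤ C) (hat : a ≤ t) :
    ((expMeasure 1).restrict {e | hittingTime φ a t e ≤ t}).map (hittingTime φ a t) =
      (volume.restrict (Ioc a t)).withDensity
        (fun w => ENNReal.ofReal (φ w * Real.exp (-∫ u in a..w, φ u))) := by
  have hcont : Continuous fun w => ∫ u in a..w, φ u := intervalIntegral.continuous_primitive hφ a
  have hτ := measurable (a := a) (t := t) hφ h0
  refine Measure.ext_of_Iic _ _ fun v => ?_
  rw [Measure.map_apply hτ measurableSet_Iic, Measure.restrict_apply (hτ measurableSet_Iic),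
    withDensity_apply _ measurableSet_Iic, Measure.restrict_restrict measurableSet_Iic]
  rcases lt_or_ge v a with hv | hv
  · have h1 : hittingTime φ a t ⁻¹' Iic v ∩ {e | hittingTime φ a t e ≤ t} = ∅ := by
      ext e
      have := le_self hφ hat e
      simp only [mem_inter_iff, mem_preimage, mem_Iic, mem_empty_iff_false, iff_false, not_and]
      intro h; linarith
    have h2 : Iic v ∩ Ioc a t = ∅ := by
      ext w
      simp only [mem_inter_iff, mem_Iic, mem_Ioc, mem_empty_iff_false, iff_false, not_and]
      intro h h'; linarith
    simp [h1, h2]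
  · have hm : min v t ∈ Icc a t := ⟨le_min hv hat, min_le_right _ _⟩
    have h1 : hittingTime φ a t ⁻¹' Iic v ∩ {e | hittingTime φ a t e ≤ t} =
        Iic (∫ w in a..min v t, φ w) := by
      ext e
      rw [mem_Iic, ← le_iff_of_mem hφ h0 hm, le_min_iff]
      rfl
    have h2 : Iic v ∩ Ioc a t = Ioc a (min v t) := by
      ext w
      simp only [mem_inter_iff, mem_Iic, mem_Ioc, le_min_iff]
      tauto
    have hnn : 0 ≤ ∫ w in a..min v t, φ w := intervalIntegral.integral_nonneg hm.1 fun w _ => h0 w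
    have hint : IntervalIntegrable (fun w => φ w * Real.exp (-∫ u in a..w, φ u)) volume a
        (min v t) :=
      (hφ _ _).mul_continuousOn (Real.continuous_exp.comp hcont.neg).continuousOn
    rw [h1, h2, expMeasure_Iic hnn, ← integral_density hφ h0 hC hm.1,
      intervalIntegral.integral_of_le hm.1, ofReal_integral_eq_lintegral_ofReal]
    · exact (intervalIntegrable_iff_integrableOn_Ioc_of_le hm.1).1 hint
    · exact Filter.Eventually.of_forall fun w => mul_nonneg (h0 w) (Real.exp_pos _).le

lemma integrable_ite {C : ℝ} (hφ : ∀ a b, IntervalIntegrable φ volume a b)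
    (h0 : ∀ w, 0 ≤ φ w) (hat : a ≤ t) {d : ℝ → ℝ} (hdm : Measurable d)
    (hd : ∀ v ∈ Icc a t, |d v| ≤ C) :
    Integrable (fun e => if hittingTime φ a t e ≤ t then d (hittingTime φ a t e) else 0)
      (expMeasure 1) := by
  have hτ := measurable (a := a) (t := t) hφ h0
  refine Integrable.of_bound (C := max C 0) (Measurable.ite (hτ measurableSet_Iic) (hdm.comp hτ)
    measurable_const).aestronglyMeasurable (Filter.Eventually.of_forall fun e => ?_)
  split_ifs with h
  · exact (hd _ ⟨le_self hφ hat e, h⟩).trans (le_max_left _ _)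
  · simp

/-- The expectation of a reward `d` paid at the epoch, if this is not after the horizon. With
`d = g - g₁` this is the compensator formula `E[d(τ); τ ≤ t] = E[∫ φ * d]`, cf.
`integral_running`. -/
lemma integral_ite {C : ℝ} (hφm : Measurable φ) (hφ : ∀ a b, IntervalIntegrable φ volume a b)
    (h0 : ∀ w, 0 ≤ φ w) (hC : ∀ w, φ w ≤ C) (hat : a ≤ t) {d : ℝ → ℝ} (hd : Measurable d) :
    ∫ e, (if hittingTime φ a t e ≤ t then d (hittingTime φ a t e) else 0) ∂(expMeasure 1) =
      ∫ w in a..t, Real.exp (-∫ u in a..w, φ u) * (φ w * d w) := by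
  have hτ := measurable (a := a) (t := t) hφ h0
  have hcont : Continuous fun w => ∫ u in a..w, φ u := intervalIntegral.continuous_primitive hφ a
  have hset : MeasurableSet {e | hittingTime φ a t e ≤ t} := hτ measurableSet_Iic
  have h1 : ∫ e, (if hittingTime φ a t e ≤ t then d (hittingTime φ a t e) else 0) ∂(expMeasure 1) =
      ∫ e in {e | hittingTime φ a t e ≤ t}, d (hittingTime φ a t e) ∂(expMeasure 1) := by
    rw [← integral_indicator hset]
    rfl
  have hdens : Measurable fun w => ENNReal.ofReal (φ w * Real.exp (-∫ u in a..w, φ u)) :=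
    (hφm.mul (Real.continuous_exp.comp hcont.neg).measurable).ennreal_ofReal
  rw [h1, ← integral_map hτ.aemeasurable hd.aestronglyMeasurable,
    map_eq_withDensity hφ h0 hC hat,
    integral_withDensity_eq_integral_toReal_smul hdens
      (Filter.Eventually.of_forall fun _ => ENNReal.ofReal_lt_top),
    intervalIntegral.integral_of_le hat]
  refine integral_congr_ae (Filter.Eventually.of_forall fun w => ?_)
  simp only [smul_eq_mul]
  rw [ENNReal.toReal_ofReal (mul_nonneg (h0 w) (Real.exp_pos _).le)]
  ring

/-- A running reward `h` that is collected up to the epoch: expectation by Fubini. -/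
lemma integral_running (hφ : ∀ a b, IntervalIntegrable φ volume a b)
    (h0 : ∀ w, 0 ≤ φ w) (hat : a ≤ t) {h : ℝ → ℝ} (hh : IntervalIntegrable h volume a t) :
    Integrable (fun e => ∫ w in a..min (hittingTime φ a t e) t, h w) (expMeasure 1) ∧
    ∫ e, (∫ w in a..min (hittingTime φ a t e) t, h w) ∂(expMeasure 1) =
      ∫ w in a..t, Real.exp (-∫ u in a..w, φ u) * h w := by
  have hcont : Continuous fun w => ∫ u in a..w, φ u := intervalIntegral.continuous_primitive hφ a
  have hset : MeasurableSet {p : ℝ × ℝ | ∫ u in a..p.2, φ u < p.1} :=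
    measurableSet_lt (hcont.measurable.comp measurable_snd) measurable_fst
  have hh' : Integrable h (volume.restrict (Ioc a t)) :=
    (intervalIntegrable_iff_integrableOn_Ioc_of_le hat).1 hh
  have hint : Integrable ({p : ℝ × ℝ | ∫ u in a..p.2, φ u < p.1}.indicator fun p => h p.2)
      ((expMeasure 1).prod (volume.restrict (Ioc a t))) := (hh'.comp_snd _).indicator hset
  have hpath : ∀ e, ∫ w in a..min (hittingTime φ a t e) t, h w =
      ∫ w in Ioc a t, {p : ℝ × ℝ | ∫ u in a..p.2, φ u < p.1}.indicator (fun p => h p.2) (e, w) := by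
    intro e
    have hm : a ≤ min (hittingTime φ a t e) t := le_min (le_self hφ hat e) hat
    have hsub : Ioc a (min (hittingTime φ a t e) t) ⊆ Ioc a t :=
      Ioc_subset_Ioc_right (min_le_right _ _)
    rw [intervalIntegral.integral_of_le hm, ← inter_eq_self_of_subset_right hsub,
      ← setIntegral_indicator measurableSet_Ioc]
    refine integral_congr_ae ?_
    have hne : ∀ᵐ w ∂(volume.restrict (Ioc a t)), w ≠ hittingTime φ a t e :=
      ae_restrict_of_ae (Measure.ae_ne volume _)
    filter_upwards [hne, ae_restrict_mem measurableSet_Ioc] with w hw hwm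
    have hiff := le_iff_of_mem hφ h0 (e := e) (Ioc_subset_Icc_self hwm)
    by_cases hc : ∫ u in a..w, φ u < e
    · have h1 : w < hittingTime φ a t e := by
        rw [← not_le, hiff, not_le]; exact hc
      rw [indicator_of_mem (show w ∈ Ioc a _ from ⟨hwm.1, le_min h1.le hwm.2⟩), indicator_of_mem]
      exact hc
    · have h1 : hittingTime φ a t e < w := lt_of_le_of_ne (hiff.2 (not_lt.1 hc)) hw.symm
      rw [indicator_of_notMem (fun h2 => ?_), indicator_of_notMem (by exact hc)]
      exact absurd ((h2.2.trans (min_le_left _ _))) (not_le.2 h1)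
  simp_rw [hpath]
  refine ⟨hint.integral_prod_left, ?_⟩
  rw [integral_integral_swap (f := fun e w =>
    {p : ℝ × ℝ | ∫ u in a..p.2, φ u < p.1}.indicator (fun p => h p.2) (e, w)) hint,
    intervalIntegral.integral_of_le hat]
  refine setIntegral_congr_fun measurableSet_Ioc fun w hw => ?_
  have hnn : 0 ≤ ∫ u in a..w, φ u := intervalIntegral.integral_nonneg hw.1.le fun w _ => h0 w
  have : (fun e => {p : ℝ × ℝ | ∫ u in a..p.2, φ u < p.1}.indicator (fun p => h p.2) (e, w)) =
      (Ioi (∫ u in a..w, φ u)).indicator fun _ => h w := rfl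
  simp only [this]
  rw [integral_indicator_const _ measurableSet_Ioi, expMeasure_real_Ioi hnn, smul_eq_mul]

/-- Verification over a single stage. Until the next increment (or the horizon) revenue accrues at
rate `ρ`; an increment at time `v` is followed by the value `g₁ v`, and `g t` is earned at the
horizon otherwise. If `g` decreases at rate `γ`, the expected profit of the stage falls short of
`g a` by the discounted defect `γ - ρ + φ * (g - g₁)` of the optimality equation. -/
lemma integral_stage {C : ℝ} (hφm : Measurable φ) (hφ : ∀ a b, IntervalIntegrable φ volume a b)
    (h0 : ∀ w, 0 ≤ φ w) (hC : ∀ w, φ w ≤ C) (hat : a ≤ t) {ρ g g₁ γ : ℝ → ℝ}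
    (hρ : ∀ a b, IntervalIntegrable ρ volume a b) (hg : Continuous g) (hg₁ : Continuous g₁)
    (hγ : Continuous γ) (hderiv : ∀ w ∈ Icc a t, HasDerivWithinAt g (-γ w) (Icc a t) w) :
    Integrable (fun e => if hittingTime φ a t e ≤ t then
        (∫ w in a..hittingTime φ a t e, ρ w) + g₁ (hittingTime φ a t e)
      else (∫ w in a..t, ρ w) + g t) (expMeasure 1) ∧
    ∫ e, (if hittingTime φ a t e ≤ t then
        (∫ w in a..hittingTime φ a t e, ρ w) + g₁ (hittingTime φ a t e)
      else (∫ w in a..t, ρ w) + g t) ∂(expMeasure 1) =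
      g a - ∫ w in a..t, Real.exp (-∫ u in a..w, φ u) * (γ w - ρ w + φ w * (g w - g₁ w)) := by
  have hcont : Continuous fun w => ∫ u in a..w, φ u := intervalIntegral.continuous_primitive hφ a
  have hFTC : ∀ m ∈ Icc a t, ∫ w in a..m, -γ w = g m - g a := by
    intro m hm
    refine intervalIntegral.integral_eq_sub_of_hasDerivAt_of_le hm.1 hg.continuousOn
      (fun w hw => ?_) (hγ.neg.intervalIntegrable _ _)
    have hw' : w ∈ Ioo a t := ⟨hw.1, hw.2.trans_le hm.2⟩
    exact (hderiv w (Ioo_subset_Icc_self hw')).hasDerivAt (Icc_mem_nhds hw'.1 hw'.2)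
  -- by the fundamental theorem of calculus for `g`, path by path
  have hpath : ∀ e, (if hittingTime φ a t e ≤ t then
        (∫ w in a..hittingTime φ a t e, ρ w) + g₁ (hittingTime φ a t e)
      else (∫ w in a..t, ρ w) + g t) =
      g a + (∫ w in a..min (hittingTime φ a t e) t, (ρ w - γ w)) -
        (if hittingTime φ a t e ≤ t then
          g (hittingTime φ a t e) - g₁ (hittingTime φ a t e) else 0) := by
    intro e
    have hm : min (hittingTime φ a t e) t ∈ Icc a t :=
      ⟨le_min (le_self hφ hat e) hat, min_le_right _ _⟩
    have h1 : ∫ w in a..min (hittingTime φ a t e) t, (ρ w - γ w) =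
        (∫ w in a..min (hittingTime φ a t e) t, ρ w) + (g (min (hittingTime φ a t e) t) - g a) := by
      rw [← hFTC _ hm, intervalIntegral.integral_neg,
        intervalIntegral.integral_sub (hρ _ _) (hγ.intervalIntegrable _ _), sub_eq_add_neg]
    rw [h1]
    split_ifs with h
    · rw [min_eq_left h]; ring
    · rw [min_eq_right (not_le.1 h).le]; ring
  obtain ⟨K, hK⟩ := isCompact_Icc.exists_bound_of_continuousOn
    ((hg.sub hg₁).continuousOn (s := Icc a t))
  have hrun := integral_running hφ h0 hat ((hρ a t).sub (hγ.intervalIntegrable a t))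
  have hite := integrable_ite hφ h0 hat (hg.sub hg₁).measurable hK
  simp_rw [hpath]
  have hadd := (integrable_const (g a)).add hrun.1
  refine ⟨hadd.sub hite, ?_⟩
  have h2 := integral_ite hφm hφ h0 hC hat (hg.sub hg₁).measurable
  simp only [Pi.sub_apply, Pi.add_def] at h2 hite hrun hadd
  rw [integral_sub hadd hite,
    integral_add (integrable_const _) hrun.1, hrun.2, h2]
  have hexp : ContinuousOn (fun w => Real.exp (-∫ u in a..w, φ u)) (uIcc a t) :=
    (Real.continuous_exp.comp hcont.neg).continuousOn
  have hi1 := ((hρ a t).sub (hγ.intervalIntegrable a t)).continuousOn_mul hexp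
  have hi2 := ((hφ a t).mul_continuousOn ((hg.sub hg₁).continuousOn)).continuousOn_mul hexp
  simp only [Pi.sub_apply] at hi1 hi2
  rw [integral_const, probReal_univ, one_smul, add_sub_assoc,
    ← intervalIntegral.integral_sub hi1 hi2,
    sub_eq_add_neg (g a), ← intervalIntegral.integral_neg]
  congr 1
  refine intervalIntegral.integral_congr fun w _ => ?_
  ring

end hittingTime

/-! ### Profit, one increment at a time -/

/-- The profit from the last epoch of the history `h` up to the horizon `t` when the future
thresholds are `es`: revenue accrues at rate `ρ`, increments occur with intensity `φ`, both
depending on the history, and `κ` is the final cost as a function of the number of increments. -/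
def stagedProfit (ρ φ : List ℝ → ℝ → ℝ) (κ : ℕ → ℝ) (t : ℝ) : List ℝ → List ℝ → ℝ
  | h, [] => (∫ w in (h.headD 0)..t, ρ h w) - κ h.length
  | h, e :: es =>
    if hittingTime (φ h) (h.headD 0) t e ≤ t then
      (∫ w in (h.headD 0)..(hittingTime (φ h) (h.headD 0) t e), ρ h w) +
        stagedProfit ρ φ κ t (hittingTime (φ h) (h.headD 0) t e :: h) es
    else (∫ w in (h.headD 0)..t, ρ h w) - κ h.length

/-- Functions of the history and the time that are jointly measurable, for each length of the
history, and bounded. -/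
structure IsBoundedRate (F : List ℝ → ℝ → ℝ) (C : ℝ) : Prop where
  measurable : ∀ n : ℕ, Measurable fun p : (Fin n → ℝ) × ℝ => F (List.ofFn p.1) p.2
  abs_le : ∀ h w, |F h w| ≤ C

lemma measurable_intervalIntegral {α : Type*} [MeasurableSpace α] {F : α × ℝ → ℝ}
    (hF : Measurable F) {A B : α → ℝ} (hA : Measurable A) (hB : Measurable B) :
    Measurable fun x => ∫ w in (A x)..(B x), F (x, w) := by
  have key : ∀ {A B : α → ℝ}, Measurable A → Measurable B →
      Measurable fun x => ∫ w in Ioc (A x) (B x), F (x, w) := by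
    intro A B hA hB
    have hset : MeasurableSet {p : α × ℝ | p.2 ∈ Ioc (A p.1) (B p.1)} :=
      (measurableSet_lt (hA.comp measurable_fst) measurable_snd).inter
        (measurableSet_le measurable_snd (hB.comp measurable_fst))
    have h1 := ((hF.indicator hset).stronglyMeasurable.integral_prod_right'
      (ν := volume)).measurable
    convert! h1 using 2 with x
    rw [← integral_indicator measurableSet_Ioc]
    rfl
  simp only [intervalIntegral]
  exact (key hA hB).sub (key hB hA)

lemma measurable_headD (m : ℕ) : Measurable fun q : Fin m → ℝ => (List.ofFn q).headD 0 := by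
  cases m with
  | zero => simp
  | succ m => simpa [List.ofFn_succ] using measurable_pi_apply 0

namespace IsBoundedRate

variable {F ρ φ : List ℝ → ℝ → ℝ} {C M : ℝ}

lemma measurable_right (hF : IsBoundedRate F C) (h : List ℝ) : Measurable (F h) := by
  have := (hF.measurable h.length).comp
    (measurable_const (a := fun i : Fin h.length => h.get i) |>.prodMk measurable_id)
  simpa [Function.comp_def] using this

lemma intervalIntegrable (hF : IsBoundedRate F C) (h : List ℝ) (a b : ℝ) :
    IntervalIntegrable (F h) volume a b := by
  refine (intervalIntegrable_const (c := C)).mono_fun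
    (hF.measurable_right h).aestronglyMeasurable (Filter.Eventually.of_forall fun w => ?_)
  exact (hF.abs_le h w).trans (le_abs_self C)

lemma measurable_hittingTime (hφ : IsBoundedRate φ C) (h0 : ∀ h w, 0 ≤ φ h w) (t : ℝ) (m : ℕ) :
    Measurable fun p : (Fin m → ℝ) × ℝ =>
      hittingTime (φ (List.ofFn p.1)) ((List.ofFn p.1).headD 0) t p.2 := by
  refine measurable_of_Iic fun v => ?_
  have hset : (fun p : (Fin m → ℝ) × ℝ =>
      hittingTime (φ (List.ofFn p.1)) ((List.ofFn p.1).headD 0) t p.2) ⁻¹' Iic v =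
      {_p | t + 1 ≤ v} ∪ ({p | (List.ofFn p.1).headD 0 ≤ min v t} ∩
        {p | p.2 ≤ ∫ w in ((List.ofFn p.1).headD 0)..min v t, φ (List.ofFn p.1) w}) := by
    ext p
    exact hittingTime.le_iff (hφ.intervalIntegrable _) (h0 _) _ _
  rw [hset]
  refine (MeasurableSet.const _).union (MeasurableSet.inter ?_ ?_)
  · exact measurableSet_le ((measurable_headD m).comp measurable_fst) measurable_const
  · refine measurableSet_le measurable_snd ?_
    exact (measurable_intervalIntegral (hφ.measurable m) (measurable_headD m)
      measurable_const).comp measurable_fst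

lemma measurable_stagedProfit (hρ : IsBoundedRate ρ M) (hφ : IsBoundedRate φ C)
    (h0 : ∀ h w, 0 ≤ φ h w) (κ : ℕ → ℝ) (t : ℝ) (n : ℕ) :
    ∀ m, Measurable fun p : (Fin m → ℝ) × (Fin n → ℝ) =>
      stagedProfit ρ φ κ t (List.ofFn p.1) (List.ofFn p.2) := by
  have hend : ∀ m, Measurable fun q : Fin m → ℝ =>
      (∫ w in ((List.ofFn q).headD 0)..t, ρ (List.ofFn q) w) - κ (List.ofFn q).length := by
    intro m
    simp only [List.length_ofFn]
    exact (measurable_intervalIntegral (hρ.measurable m) (measurable_headD m)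
      measurable_const).sub_const _
  induction n with
  | zero =>
    intro m
    simpa [stagedProfit, Function.comp_def] using (hend m).comp measurable_fst
  | succ n ih =>
    intro m
    have hτ : Measurable fun p : (Fin m → ℝ) × (Fin (n + 1) → ℝ) =>
        hittingTime (φ (List.ofFn p.1)) ((List.ofFn p.1).headD 0) t (p.2 0) := by
      have hpair : Measurable fun p : (Fin m → ℝ) × (Fin (n + 1) → ℝ) => (p.1, p.2 0) :=
        measurable_fst.prodMk measurable_snd.eval
      have h1 := (hφ.measurable_hittingTime h0 t m).comp hpair
      simp only [Function.comp_def] at h1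
      exact h1
    have hrec : Measurable fun p : (Fin m → ℝ) × (Fin (n + 1) → ℝ) =>
        stagedProfit ρ φ κ t
          (hittingTime (φ (List.ofFn p.1)) ((List.ofFn p.1).headD 0) t (p.2 0) :: List.ofFn p.1)
          (List.ofFn fun i => p.2 (Fin.succ i)) := by
      have hpair : Measurable fun p : (Fin m → ℝ) × (Fin (n + 1) → ℝ) =>
          ((Fin.cons (hittingTime (φ (List.ofFn p.1)) ((List.ofFn p.1).headD 0) t (p.2 0)) p.1 :
            Fin (m + 1) → ℝ), fun i : Fin n => p.2 (Fin.succ i)) := by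
        refine Measurable.prodMk (measurable_pi_lambda _ fun i => ?_)
          (measurable_pi_lambda _ fun i => (measurable_pi_apply _).comp measurable_snd)
        refine Fin.cases ?_ (fun i => ?_) i
        · simpa using hτ
        · simp only [Fin.cons_succ]
          exact (measurable_pi_apply i).comp measurable_fst
      have h1 := (ih (m + 1)).comp hpair
      simp only [Function.comp_def, List.ofFn_cons] at h1
      exact h1
    have hrun : Measurable fun p : (Fin m → ℝ) × (Fin (n + 1) → ℝ) =>
        ∫ w in ((List.ofFn p.1).headD 0)..(hittingTime (φ (List.ofFn p.1))
          ((List.ofFn p.1).headD 0) t (p.2 0)), ρ (List.ofFn p.1) w :=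
      measurable_intervalIntegral (F := fun q : ((Fin m → ℝ) × (Fin (n + 1) → ℝ)) × ℝ =>
          ρ (List.ofFn q.1.1) q.2)
        ((hρ.measurable m).comp ((measurable_fst.comp measurable_fst).prodMk measurable_snd))
        ((measurable_headD m).comp measurable_fst) hτ
    simp only [List.ofFn_succ (n := n), stagedProfit]
    have hfst : Measurable fun p : (Fin m → ℝ) × (Fin (n + 1) → ℝ) => p.1 := measurable_fst
    have hend' := (hend m).comp hfst
    simp only [Function.comp_def] at hend'
    have hset : MeasurableSet {p : (Fin m → ℝ) × (Fin (n + 1) → ℝ) |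
        hittingTime (φ (List.ofFn p.1)) ((List.ofFn p.1).headD 0) t (p.2 0) ≤ t} :=
      measurableSet_le hτ measurable_const
    have hadd := hrun.add hrec
    simp only [Pi.add_def] at hadd
    exact Measurable.ite hset hadd hend'

lemma abs_stagedProfit_le (hρ : IsBoundedRate ρ M) (hφ : IsBoundedRate φ C) {κ : ℕ → ℝ} {K t : ℝ}
    (es : List ℝ) : ∀ h : List ℝ, h.headD 0 ≤ t → (∀ m ≤ h.length + es.length, |κ m| ≤ K) →
      |stagedProfit ρ φ κ t h es| ≤ M * (t - h.headD 0) + K := by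
  have hint : ∀ (h : List ℝ) (v : ℝ), h.headD 0 ≤ v →
      |∫ w in (h.headD 0)..v, ρ h w| ≤ M * (v - h.headD 0) := by
    intro h v hv
    have := intervalIntegral.norm_integral_le_of_norm_le_const (a := h.headD 0) (b := v)
      (f := ρ h) (C := M) fun w _ => hρ.abs_le h w
    rwa [abs_of_nonneg (sub_nonneg.2 hv)] at this
  have hend : ∀ h : List ℝ, h.headD 0 ≤ t → |κ h.length| ≤ K →
      |(∫ w in (h.headD 0)..t, ρ h w) - κ h.length| ≤ M * (t - h.headD 0) + K :=
    fun h ht hK => (abs_sub _ _).trans (add_le_add (hint h t ht) hK)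
  induction es with
  | nil => exact fun h ht hK => hend h ht (hK _ (by simp))
  | cons e es ih =>
    intro h ht hK
    rw [stagedProfit]
    split_ifs with hτ
    · have h1 := hittingTime.le_self (φ := φ h) (hφ.intervalIntegrable h) ht e
      have h2 := hint h _ h1
      have h3 := ih (hittingTime (φ h) (h.headD 0) t e :: h) hτ
        fun m hm => hK m (by simp at hm ⊢; omega)
      rw [List.headD_cons] at h3
      refine (abs_add_le _ _).trans ((add_le_add h2 h3).trans (le_of_eq ?_))
      ring
    · exact hend h ht (hK _ (by simp))

/-- Independence of the thresholds: the next one may be integrated out last. -/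
lemma integral_stagedProfit_succ (hρ : IsBoundedRate ρ M) (hφ : IsBoundedRate φ C)
    (h0 : ∀ h w, 0 ≤ φ h w) {κ : ℕ → ℝ} {K t : ℝ} {n : ℕ} {h : List ℝ} (ht : h.headD 0 ≤ t)
    (hK : ∀ m ≤ h.length + (n + 1), |κ m| ≤ K) :
    Integrable (fun e => if hittingTime (φ h) (h.headD 0) t e ≤ t then
        (∫ w in (h.headD 0)..(hittingTime (φ h) (h.headD 0) t e), ρ h w) +
          ∫ ω : Fin n → ℝ, stagedProfit ρ φ κ t (hittingTime (φ h) (h.headD 0) t e :: h)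
            (List.ofFn ω) ∂(Measure.pi fun _ => expMeasure 1)
        else (∫ w in (h.headD 0)..t, ρ h w) - κ h.length) (expMeasure 1) ∧
    ∫ ω : Fin (n + 1) → ℝ, stagedProfit ρ φ κ t h (List.ofFn ω)
        ∂(Measure.pi fun _ => expMeasure 1) =
      ∫ e, (if hittingTime (φ h) (h.headD 0) t e ≤ t then
        (∫ w in (h.headD 0)..(hittingTime (φ h) (h.headD 0) t e), ρ h w) +
          ∫ ω : Fin n → ℝ, stagedProfit ρ φ κ t (hittingTime (φ h) (h.headD 0) t e :: h)
            (List.ofFn ω) ∂(Measure.pi fun _ => expMeasure 1)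
        else (∫ w in (h.headD 0)..t, ρ h w) - κ h.length) ∂(expMeasure 1) := by
  have hmeas : ∀ (n : ℕ) (h : List ℝ), Measurable fun ω : Fin n → ℝ =>
      stagedProfit ρ φ κ t h (List.ofFn ω) := by
    intro n h
    have := (hρ.measurable_stagedProfit hφ h0 κ t n h.length).comp
      ((measurable_const (a := fun i : Fin h.length => h.get i)).prodMk measurable_id)
    simpa [Function.comp_def] using this
  have hpres := measurePreserving_piFinSuccAbove (fun _ : Fin (n + 1) => expMeasure 1) 0
  have hcons : ∀ p : ℝ × (Fin n → ℝ),
      List.ofFn ((MeasurableEquiv.piFinSuccAbove (fun _ => ℝ) 0).symm p) =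
        p.1 :: List.ofFn p.2 := by
    intro p
    simp [MeasurableEquiv.piFinSuccAbove_symm_apply, Fin.insertNthEquiv, List.ofFn_succ]
  have hint : Integrable (fun p : ℝ × (Fin n → ℝ) =>
      stagedProfit ρ φ κ t h (p.1 :: List.ofFn p.2))
      ((expMeasure 1).prod (Measure.pi fun _ => expMeasure 1)) := by
    refine Integrable.of_bound (C := M * (t - h.headD 0) + K) ?_
      (Filter.Eventually.of_forall fun p => hρ.abs_stagedProfit_le hφ _ h ht fun m hm =>
        hK m (by simpa using hm))
    have := (hmeas (n + 1) h).comp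
      (MeasurableEquiv.piFinSuccAbove (fun _ : Fin (n + 1) => ℝ) 0).symm.measurable
    simp only [Function.comp_def, hcons] at this
    exact this.aestronglyMeasurable
  have hinner : ∀ e, ∫ ω : Fin n → ℝ, stagedProfit ρ φ κ t h (e :: List.ofFn ω)
        ∂(Measure.pi fun _ => expMeasure 1) =
      if hittingTime (φ h) (h.headD 0) t e ≤ t then
        (∫ w in (h.headD 0)..(hittingTime (φ h) (h.headD 0) t e), ρ h w) +
          ∫ ω : Fin n → ℝ, stagedProfit ρ φ κ t (hittingTime (φ h) (h.headD 0) t e :: h)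
            (List.ofFn ω) ∂(Measure.pi fun _ => expMeasure 1)
        else (∫ w in (h.headD 0)..t, ρ h w) - κ h.length := by
    intro e
    simp only [stagedProfit]
    split_ifs with hτ
    · have hi : Integrable (fun ω : Fin n → ℝ => stagedProfit ρ φ κ t
          (hittingTime (φ h) (h.headD 0) t e :: h) (List.ofFn ω))
          (Measure.pi fun _ => expMeasure 1) := by
        refine Integrable.of_bound
          (C := M * (t - hittingTime (φ h) (h.headD 0) t e) + K)
          (hmeas n _).aestronglyMeasurable
          (Filter.Eventually.of_forall fun ω => hρ.abs_stagedProfit_le hφ _ _ hτ fun m hm =>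
            hK m (by simp at hm; omega))
      rw [integral_add (integrable_const _) hi, integral_const, probReal_univ, one_smul]
    · rw [integral_const, probReal_univ, one_smul]
  have h1 := hint.integral_prod_left
  simp only [hinner] at h1
  refine ⟨h1, ?_⟩
  rw [← hpres.symm.integral_comp', ← integral_congr_ae (Filter.Eventually.of_forall hinner),
    ← integral_prod _ hint]
  simp only [hcons]

end IsBoundedRate

namespace ProductionSystem

variable {S : ProductionSystem}

/-! ### Verification -/

lemma IsValueFunction.continuous_growth {lam T : ℝ} {V : ℕ → ℝ → ℝ}
    (hV : S.IsValueFunction lam T V) (x : ℕ) : Continuous (S.growth lam V x) := by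
  unfold growth
  split_ifs
  · have := hV.continuous x
    have := hV.continuous (x + 1)
    exact S.lipschitzWith_hamiltonian.continuous.comp (by fun_prop)
  · exact continuous_const

/-- Verification: the profit rate `ρ` with intensity `φ` earns at most the value if it satisfies
the optimality equation as an inequality, and exactly the value if it attains equality. The
induction is on the number `n` of increments left until failure. -/
lemma IsValueFunction.integral_stagedProfit_le {lam T : ℝ} {V : ℕ → ℝ → ℝ}
    (hV : S.IsValueFunction lam T V) {x : ℕ} {t : ℝ} (htT : t ≤ T) {ρ φ : List ℝ → ℝ → ℝ} {M C : ℝ}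
    (hρ : IsBoundedRate ρ M) (hφ : IsBoundedRate φ C) (h0 : ∀ h w, 0 ≤ φ h w)
    (hfail : ∀ h : List ℝ, x + h.length = S.xi → ∀ w, ρ h w = S.r 0)
    (hdef : ∀ h : List ℝ, x + h.length < S.xi → ∀ w ∈ Icc 0 t,
      0 ≤ S.growth lam V (x + h.length) (t - w) - ρ h w +
        φ h w * (V (x + h.length) (t - w) - V (x + h.length + 1) (t - w))) (n : ℕ) :
    ∀ h : List ℝ, x + h.length + n = S.xi → h.headD 0 ∈ Icc 0 t →
      ∫ ω : Fin n → ℝ, stagedProfit ρ φ (fun m => S.c (x + m)) t h (List.ofFn ω)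
        ∂(Measure.pi fun _ => expMeasure 1) ≤ V (x + h.length) (t - h.headD 0) ∧
      ((∀ h : List ℝ, x + h.length < S.xi → ∀ w ∈ Icc 0 t,
          S.growth lam V (x + h.length) (t - w) - ρ h w +
            φ h w * (V (x + h.length) (t - w) - V (x + h.length + 1) (t - w)) = 0) →
        ∫ ω : Fin n → ℝ, stagedProfit ρ φ (fun m => S.c (x + m)) t h (List.ofFn ω)
          ∂(Measure.pi fun _ => expMeasure 1) = V (x + h.length) (t - h.headD 0)) := by
  induction n with
  | zero =>
    intro h hx ha
    have hx' : x + h.length = S.xi := by omega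
    have key : ∫ ω : Fin 0 → ℝ, stagedProfit ρ φ (fun m => S.c (x + m)) t h (List.ofFn ω)
        ∂(Measure.pi fun _ => expMeasure 1) = V (x + h.length) (t - h.headD 0) := by
      simp only [List.ofFn_zero, stagedProfit, hfail h hx', integral_const, probReal_univ, one_smul]
      rw [hx', hV.failed _ ⟨by linarith [ha.2], by linarith [ha.1]⟩,
        intervalIntegral.integral_const, smul_eq_mul]
      ring
    exact ⟨key.le, fun _ => key⟩
  | succ n ih =>
    intro h hx ha
    set a := h.headD 0 with ha_def
    set y := x + h.length with hy
    have hyxi : y < S.xi := by omega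
    have hK : ∀ m ≤ h.length + (n + 1), |S.c (x + m)| ≤ S.c S.xi := by
      intro m hm
      have hm' : x + m ≤ S.xi := by omega
      rw [abs_of_nonneg (S.c_nonneg _ hm')]
      exact S.c_increasing (mem_Iic.2 hm') (mem_Iic.2 le_rfl) hm'
    obtain ⟨hint, heq⟩ := hρ.integral_stagedProfit_succ hφ h0 ha.2 hK
    have hVy := hV.continuous y
    have hVy1 := hV.continuous (y + 1)
    have hγ : Continuous fun w => S.growth lam V y (t - w) :=
      (hV.continuous_growth y).comp (by fun_prop)
    have hderiv : ∀ w ∈ Icc a t, HasDerivWithinAt (fun w => V y (t - w))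
        (-S.growth lam V y (t - w)) (Icc a t) w := by
      intro w hw
      have h1 := hV.deriv y hyxi.le (t - w) ⟨by linarith [hw.2], by linarith [hw.1, ha.1]⟩
      have h2 : HasDerivWithinAt (fun w => t - w) (-1) (Icc a t) w :=
        ((hasDerivAt_id w).const_sub t).hasDerivWithinAt
      have h3 := h1.comp w h2 fun v hv => ⟨by linarith [hv.2], by linarith [hv.1, ha.1]⟩
      simpa [Function.comp_def] using h3
    obtain ⟨hint', heq'⟩ := hittingTime.integral_stage (hφ.measurable_right h)
      (hφ.intervalIntegrable h) (h0 h) (fun w => (le_abs_self _).trans (hφ.abs_le h w)) ha.2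
      (hρ.intervalIntegrable h) (g := fun w => V y (t - w)) (g₁ := fun w => V (y + 1) (t - w))
      (γ := fun w => S.growth lam V y (t - w)) (by fun_prop) (by fun_prop) hγ hderiv
    have hend : V y (t - t) = - S.c (x + h.length) := by
      rw [sub_self, hV.zero y hyxi.le]
    have hτ : ∀ e, hittingTime (φ h) a t e ≤ t →
        (hittingTime (φ h) a t e :: h).headD 0 ∈ Icc 0 t := fun e he =>
      ⟨ha.1.trans (hittingTime.le_self (hφ.intervalIntegrable h) ha.2 e), he⟩
    have hlen : ∀ v, x + (v :: h).length = y + 1 := fun v => by simp [hy, add_assoc]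
    rw [heq]
    constructor
    · calc _ ≤ _ := integral_mono hint hint' fun e => ?_
        _ = _ := heq'
        _ ≤ V y (t - a) := sub_le_self _ (intervalIntegral.integral_nonneg ha.2 fun w hw =>
          mul_nonneg (Real.exp_pos _).le (hdef h hyxi w ⟨ha.1.trans hw.1, hw.2⟩))
      simp only
      split_ifs with he
      · have h1 := (ih (hittingTime (φ h) a t e :: h) (by rw [hlen]; omega) (hτ e he)).1
        rw [hlen, List.headD_cons] at h1
        linarith
      · rw [hend]; linarith
    · intro hopt
      calc _ = _ := integral_congr_ae (Filter.Eventually.of_forall fun e => ?_)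
        _ = _ := heq'
        _ = V y (t - a) := by
          rw [intervalIntegral.integral_congr (g := fun _ => (0 : ℝ))]
          · simp
          · intro w hw
            rw [uIcc_of_le ha.2] at hw
            simp only
            rw [hopt h hyxi w ⟨ha.1.trans hw.1, hw.2⟩, mul_zero]
      split_ifs with he
      · have h1 := (ih (hittingTime (φ h) a t e :: h) (by rw [hlen]; omega) (hτ e he)).2 hopt
        rw [hlen, List.headD_cons] at h1
        rw [h1]
      · rw [hend]; ring

/-! ### Profit of a policy -/

lemma rates_subset (x : ℕ) : S.rates x ⊆ Icc 0 S.sbar := by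
  unfold rates; split_ifs
  exacts [subset_rfl, singleton_subset_iff.2 S.zero_mem_Icc]

/-- The revenue rate of a policy, extended from the horizon `[0, t]` to all times. -/
def revenueRate (S : ProductionSystem) {t : ℝ} (ht : 0 ≤ t) (u : Policy) (h : List ℝ) (w : ℝ) : ℝ :=
  S.r (u h (projIcc 0 t ht w))

/-- The intensity of the increments under a policy, extended from the horizon `[0, t]` to all
times. -/
def intensity (S : ProductionSystem) (lam : ℝ) {t : ℝ} (ht : 0 ≤ t) (u : Policy) (h : List ℝ)
    (w : ℝ) : ℝ :=
  lam * S.f (u h (projIcc 0 t ht w))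

namespace IsAdmissible

variable {x : ℕ} {lam t : ℝ} {u : Policy}

lemma mem_Icc (hu : S.IsAdmissible x t u) (ht : 0 ≤ t) (h : List ℝ) (w : ℝ) :
    u h (projIcc 0 t ht w) ∈ Icc 0 S.sbar :=
  rates_subset _ (hu.mem_rates h _ (projIcc 0 t ht w).2)

lemma measurable_comp (hu : S.IsAdmissible x t u) (ht : 0 ≤ t) {g : ℝ → ℝ}
    (hg : ContinuousOn g (Icc 0 S.sbar)) (n : ℕ) :
    Measurable fun p : (Fin n → ℝ) × ℝ => g (u (List.ofFn p.1) (projIcc 0 t ht p.2)) := by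
  have h1 : Measurable fun p : (Fin n → ℝ) × ℝ => (p.1, projIcc 0 t ht p.2) :=
    measurable_fst.prodMk (continuous_projIcc.measurable.comp measurable_snd)
  have h2 := ((hu.measurable n).comp h1).subtype_mk
    (h := fun p => hu.mem_Icc ht (List.ofFn p.1) p.2)
  exact hg.domRestrict.measurable.comp h2

lemma isBoundedRate_revenueRate (hu : S.IsAdmissible x t u) (ht : 0 ≤ t) :
    IsBoundedRate (S.revenueRate ht u) (max |S.r 0| |S.r S.sbar|) where
  measurable := hu.measurable_comp ht S.r_continuous
  abs_le h w := by
    have hm := hu.mem_Icc ht h w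
    exact abs_le_max_abs_abs (S.r_increasing S.zero_mem_Icc hm hm.1)
      (S.r_increasing hm S.sbar_mem_Icc hm.2)

lemma intensity_nonneg (hu : S.IsAdmissible x t u) (hlam : 0 ≤ lam) (ht : 0 ≤ t) (h : List ℝ)
    (w : ℝ) : 0 ≤ S.intensity lam ht u h w :=
  mul_nonneg hlam (S.f_nonneg (hu.mem_Icc ht h w))

lemma isBoundedRate_intensity (hu : S.IsAdmissible x t u) (hlam : 0 ≤ lam) (ht : 0 ≤ t) :
    IsBoundedRate (S.intensity lam ht u) (lam * S.f S.sbar) where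
  measurable n := (hu.measurable_comp ht S.f_continuous n).const_mul lam
  abs_le h w := by
    have hm := hu.mem_Icc ht h w
    rw [abs_of_nonneg (hu.intensity_nonneg hlam ht h w)]
    exact mul_le_mul_of_nonneg_left (S.f_increasing hm S.sbar_mem_Icc hm.2) hlam

/-- On histories that end at a nonnegative time, the extension of the intensity beyond `[0, t]` does
not change the next epoch. -/
lemma nextEpoch_eq_hittingTime (ht : 0 ≤ t) {h : List ℝ} (ha : 0 ≤ h.headD 0) (e : ℝ) :
    S.nextEpoch lam t u h e = hittingTime (S.intensity lam ht u h) (h.headD 0) t e := by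
  unfold nextEpoch hittingTime
  congr 2
  ext v
  refine and_congr_right fun h1 => and_congr_right fun h2 => ?_
  rw [intervalIntegral.integral_congr fun w hw => ?_]
  rw [uIcc_of_le h1] at hw
  have hw' : w ∈ Icc 0 t := ⟨ha.trans hw.1, hw.2.trans h2⟩
  simp only [intensity]
  rw [projIcc_of_mem ht hw']

/-- Later epochs are prepended to the history, and they are not earlier. -/
lemma foldl_nextEpoch (hu : S.IsAdmissible x t u) (hlam : 0 ≤ lam) (ht : 0 ≤ t) (es : List ℝ) :
    ∀ h : List ℝ, 0 ≤ h.headD 0 → h.headD 0 ≤ t + 1 → ∃ l : List ℝ,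
      es.foldl (fun h e => S.nextEpoch lam t u h e :: h) h = l ++ h ∧ ∀ v ∈ l, h.headD 0 ≤ v := by
  induction es with
  | nil => exact fun h _ _ => ⟨[], rfl, by simp⟩
  | cons e es ih =>
    intro h h1 h2
    have h3 : h.headD 0 ≤ S.nextEpoch lam t u h e ∧ S.nextEpoch lam t u h e ≤ t + 1 := by
      rw [nextEpoch_eq_hittingTime ht h1]
      rcases hittingTime.eq_or_mem (a := h.headD 0) (t := t)
        ((hu.isBoundedRate_intensity hlam ht).intervalIntegrable h) e with h4 | h4
      · rw [h4]; exact ⟨h2, le_rfl⟩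
      · exact ⟨h4.1, by linarith [h4.2.1]⟩
    obtain ⟨l, hl, hl'⟩ := ih (S.nextEpoch lam t u h e :: h) (h1.trans h3.1) h3.2
    refine ⟨l ++ [S.nextEpoch lam t u h e], by simp [hl], fun v hv => ?_⟩
    rw [List.headD_cons] at hl'
    rcases List.mem_append.1 hv with hv | hv
    · exact h3.1.trans (hl' v hv)
    · rw [List.mem_singleton.1 hv]; exact h3.1

/-- The profit of a policy from the last epoch on, computed stage by stage. The expected profit
reads the history off the complete list of epochs, by filtering; since later epochs are not earlier, this
agrees with the history at the start of the stage until the stage ends. -/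
lemma profit_eq_stagedProfit (hu : S.IsAdmissible x t u) (hlam : 0 ≤ lam) (ht : 0 ≤ t)
    (es : List ℝ) :
    ∀ h : List ℝ, h.headD 0 ∈ Icc 0 t → (∀ v ∈ h, v ≤ h.headD 0) →
      IntervalIntegrable (fun w => S.r (u
        ((es.foldl (fun h e => S.nextEpoch lam t u h e :: h) h).filter
          (fun v => decide (v ≤ w))) w)) volume (h.headD 0) t ∧
      (∫ w in (h.headD 0)..t, S.r (u
        ((es.foldl (fun h e => S.nextEpoch lam t u h e :: h) h).filter
          (fun v => decide (v ≤ w))) w)) -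
        S.c (x + ((es.foldl (fun h e => S.nextEpoch lam t u h e :: h) h).filter
          (fun v => decide (v ≤ t))).length) =
      stagedProfit (S.revenueRate ht u) (S.intensity lam ht u) (fun m => S.c (x + m)) t h es := by
  have hρ := hu.isBoundedRate_revenueRate ht
  have hfilter : ∀ h : List ℝ, (∀ v ∈ h, v ≤ h.headD 0) → ∀ w, h.headD 0 ≤ w →
      h.filter (fun v => decide (v ≤ w)) = h := fun h hh w hw =>
    List.filter_eq_self.2 fun v hv => by simpa using (hh v hv).trans hw
  have hrate : ∀ (h : List ℝ), ∀ w ∈ Icc 0 t, S.revenueRate ht u h w = S.r (u h w) := by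
    intro h w hw
    rw [revenueRate, projIcc_of_mem ht hw]
  -- as long as no further increment occurs, the history is `h`
  have hconst : ∀ (h l : List ℝ) (b : ℝ), h.headD 0 ∈ Icc 0 t → (∀ v ∈ h, v ≤ h.headD 0) →
      h.headD 0 ≤ b → b ≤ t → (∀ w < b, (l ++ h).filter (fun v => decide (v ≤ w)) =
        h.filter (fun v => decide (v ≤ w))) →
      IntervalIntegrable (fun w => S.r (u ((l ++ h).filter (fun v => decide (v ≤ w))) w)) volume
        (h.headD 0) b ∧
      ∫ w in (h.headD 0)..b, S.r (u ((l ++ h).filter (fun v => decide (v ≤ w))) w) =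
        ∫ w in (h.headD 0)..b, S.revenueRate ht u h w := by
    intro h l b ha hh hab hbt hl
    have hae : ∀ᵐ w, w ∈ uIoc (h.headD 0) b → S.revenueRate ht u h w =
        S.r (u ((l ++ h).filter (fun v => decide (v ≤ w))) w) := by
      filter_upwards [Measure.ae_ne volume b] with w hw hwm
      rw [uIoc_of_le hab] at hwm
      rw [hl w (lt_of_le_of_ne hwm.2 hw), hfilter h hh w hwm.1.le,
        hrate h w ⟨ha.1.trans hwm.1.le, hwm.2.trans hbt⟩]
    exact ⟨(hρ.intervalIntegrable h _ _).congr_ae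
      ((ae_restrict_iff' measurableSet_uIoc).2 hae),
      (intervalIntegral.integral_congr_ae hae).symm⟩
  induction es with
  | nil =>
    intro h ha hh
    have h1 := hconst h [] t ha hh ha.2 le_rfl fun w _ => rfl
    simp only [List.nil_append] at h1
    refine ⟨h1.1, ?_⟩
    simp only [List.foldl_nil]
    rw [h1.2, hfilter h hh t ha.2]
    rfl
  | cons e es ih =>
    intro h ha hh
    simp only [List.foldl_cons, stagedProfit]
    have hτ := nextEpoch_eq_hittingTime (S := S) (lam := lam) (u := u) ht ha.1 e
    rw [← hτ]
    set τ := S.nextEpoch lam t u h e with hτ_def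
    have hint := (hu.isBoundedRate_intensity hlam ht).intervalIntegrable h
    have haτ : h.headD 0 ≤ τ := hτ ▸ hittingTime.le_self hint ha.2 e
    have hτt : τ ≤ t + 1 := by
      rcases hittingTime.eq_or_mem (a := h.headD 0) (t := t) hint e with h4 | h4
      · exact (hτ.trans h4).le
      · rw [hτ]; linarith [h4.2.1]
    obtain ⟨l, hl, hl'⟩ := hu.foldl_nextEpoch hlam ht es (τ :: h) (ha.1.trans haτ) hτt
    rw [List.headD_cons] at hl'
    have hfil : ∀ w < τ, ((l ++ [τ]) ++ h).filter (fun v => decide (v ≤ w)) =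
        h.filter (fun v => decide (v ≤ w)) := by
      intro w hw
      suffices h : (l ++ [τ]).filter (fun v => decide (v ≤ w)) = [] by
        rw [List.filter_append, h, List.nil_append]
      rw [List.filter_eq_nil_iff]
      intro v hv
      have : τ ≤ v := by
        rcases List.mem_append.1 hv with hv | hv
        · exact hl' v hv
        · exact (List.mem_singleton.1 hv).ge
      simpa using hw.trans_le this
    have hl2 : l ++ τ :: h = (l ++ [τ]) ++ h := by simp
    split_ifs with hc
    -- an increment at time `τ ≤ t`: split the revenue at `τ`
    · have h1 := hconst h (l ++ [τ]) τ ha hh haτ hc hfil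
      have h2 := ih (τ :: h) ⟨ha.1.trans haτ, hc⟩ fun v hv => by
        rcases List.mem_cons.1 hv with rfl | hv
        · exact le_rfl
        · exact (hh v hv).trans haτ
      rw [List.headD_cons] at h2
      rw [← h2.2]
      rw [hl] at h2 ⊢
      rw [hl2] at h2 ⊢
      refine ⟨h1.1.trans h2.1, ?_⟩
      rw [← intervalIntegral.integral_add_adjacent_intervals h1.1 h2.1, h1.2]
      ring
    -- no increment up to `t`: the epochs after `h` all exceed `t` and are filtered out
    · have hc' := not_le.1 hc
      have h1 := hconst h (l ++ [τ]) t ha hh ha.2 le_rfl fun w hw => hfil w (hw.trans hc')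
      rw [hl, hl2]
      refine ⟨h1.1, ?_⟩
      rw [h1.2, hfil t hc', hfilter h hh t ha.2]

lemma expectedProfit_eq (hu : S.IsAdmissible x t u) (hlam : 0 ≤ lam) (ht : 0 ≤ t) :
    S.expectedProfit lam x t u =
      ∫ ω : Fin (S.xi - x) → ℝ, stagedProfit (S.revenueRate ht u) (S.intensity lam ht u)
        (fun m => S.c (x + m)) t [] (List.ofFn ω) ∂(Measure.pi fun _ => expMeasure 1) := by
  refine integral_congr_ae (Filter.Eventually.of_forall fun ω => ?_)
  exact (hu.profit_eq_stagedProfit hlam ht (List.ofFn ω) [] ⟨le_rfl, ht⟩ (by simp)).2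

end IsAdmissible

/-! ### The optimal profit and the optimal rates -/

namespace IsValueFunction

variable {lam T : ℝ} {V : ℕ → ℝ → ℝ} {x : ℕ} {t : ℝ}

/-- No admissible policy earns more than the value, and a policy whose rates are maximizers at every
history and time earns exactly the value. -/
lemma expectedProfit_le_and_eq (hV : S.IsValueFunction lam T V) (hlam : 0 ≤ lam) (hx : x ≤ S.xi)
    (ht : t ∈ Icc 0 T) {u : Policy} (hu : S.IsAdmissible x t u) :
    S.expectedProfit lam x t u ≤ V x t ∧
    ((∀ h : List ℝ, x + h.length < S.xi → ∀ w ∈ Icc 0 t,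
        u h w ∈ S.maximizers (lam * (V (x + h.length) (t - w) - V (x + h.length + 1) (t - w)))) →
      S.expectedProfit lam x t u = V x t) := by
  have hΔ : ∀ h : List ℝ, x + h.length < S.xi → ∀ w ∈ Icc 0 t,
      0 ≤ lam * (V (x + h.length) (t - w) - V (x + h.length + 1) (t - w)) := fun h hh w hw =>
    mul_nonneg hlam (hV.sub_nonneg hlam hh ⟨by linarith [hw.2], by linarith [hw.1, ht.2]⟩)
  have key := hV.integral_stagedProfit_le (x := x) ht.2 (hu.isBoundedRate_revenueRate ht.1)
    (hu.isBoundedRate_intensity hlam ht.1) (hu.intensity_nonneg hlam ht.1)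
    (fun h hh w => ?_) (fun h hh w hw => ?_) (S.xi - x) [] (by simp; omega) ⟨le_rfl, ht.1⟩
  · rw [hu.expectedProfit_eq hlam ht.1]
    simp only [List.length_nil, add_zero, List.headD_nil, sub_zero] at key
    refine ⟨key.1, fun hopt => key.2 fun h hh w hw => ?_⟩
    rw [growth, if_pos hh, S.hamiltonian_eq_of_mem_maximizers (hΔ h hh w hw) (hopt h hh w hw),
      revenueRate, intensity, projIcc_of_mem ht.1 hw]
    ring
  · have h1 := hu.mem_rates h _ (projIcc 0 t ht.1 w).2
    rw [rates, if_neg (by omega), mem_singleton_iff] at h1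
    rw [revenueRate, h1]
  · have h1 := S.le_hamiltonian
      (lam * (V (x + h.length) (t - w) - V (x + h.length + 1) (t - w))) (hu.mem_Icc ht.1 h w)
    rw [max_eq_left (hΔ h hh w hw)] at h1
    rw [growth, if_pos hh, revenueRate, intensity]
    linarith

/-- The feedback policy that uses the largest maximizers. It is measurable since these decrease in
the time left. -/
lemma exists_policy (hV : S.IsValueFunction lam T V) (hlam : 0 ≤ lam) (x : ℕ)
    (ht : t ∈ Icc 0 T) : ∃ u, S.IsAdmissible x t u ∧
      ∀ h : List ℝ, x + h.length < S.xi → ∀ w ∈ Icc 0 t,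
        u h w ∈ S.maximizers (lam * (V (x + h.length) (t - w) - V (x + h.length + 1) (t - w))) := by
  have hgreat : ∀ d, IsGreatest (S.maximizers d) (sSup (S.maximizers d)) := fun d =>
    (S.isCompact_maximizers d).isGreatest_sSup (S.maximizers_nonempty d)
  refine ⟨fun h w => if x + h.length < S.xi then
    sSup (S.maximizers (lam * (V (x + h.length) (t - w) - V (x + h.length + 1) (t - w)))) else 0,
    ⟨fun n => ?_, fun h w _ => ?_⟩, fun h hh w _ => ?_⟩
  · simp only [List.length_ofFn]
    split_ifs with hn
    · have hmono : Monotone fun w : Icc (0 : ℝ) t =>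
          sSup (S.maximizers (lam * (V (x + n) (t - w) - V (x + n + 1) (t - w)))) := by
        intro w w' hww
        refine (S.strongSetLE_maximizers (mul_le_mul_of_nonneg_left ?_ hlam)).isGreatest_le
          (hgreat _) (hgreat _)
        have hww' : (w : ℝ) ≤ w' := hww
        refine hV.monotoneOn_sub hlam hn ⟨?_, ?_⟩ ⟨?_, ?_⟩ ?_ <;>
          linarith [w.2.1, w.2.2, w'.2.1, w'.2.2, ht.2]
      exact hmono.measurable.comp measurable_snd
    · exact measurable_const
  · simp only [rates]
    split_ifs
    · exact (hgreat _).1.1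
    · rfl
  · simp only [if_pos hh]
    exact (hgreat _).1

lemma optimalProfit_eq (hV : S.IsValueFunction lam T V) (hlam : 0 ≤ lam) (hx : x ≤ S.xi)
    (ht : t ∈ Icc 0 T) : S.optimalProfit lam x t = V x t := by
  obtain ⟨u, hu, hopt⟩ := hV.exists_policy hlam x ht
  have : Nonempty {u : Policy // S.IsAdmissible x t u} := ⟨⟨u, hu⟩⟩
  refine le_antisymm (ciSup_le fun v => (hV.expectedProfit_le_and_eq hlam hx ht v.2).1) ?_
  rw [← (hV.expectedProfit_le_and_eq hlam hx ht hu).2 hopt]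
  exact le_ciSup (f := fun v : {u : Policy // S.IsAdmissible x t u} => S.expectedProfit lam x t v.1)
    ⟨V x t, by rintro _ ⟨v, rfl⟩; exact (hV.expectedProfit_le_and_eq hlam hx ht v.2).1⟩ ⟨u, hu⟩

lemma optimalRates_eq (hV : S.IsValueFunction lam T V) (hlam : 0 ≤ lam) (hx : x < S.xi)
    (ht : t ∈ Icc 0 T) : S.optimalRates lam x t = S.maximizers (lam * (V x t - V (x + 1) t)) := by
  unfold optimalRates maximizers marginalValue
  rw [hV.optimalProfit_eq hlam hx.le ht, hV.optimalProfit_eq hlam hx ht, rates, if_pos hx]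
  have : (fun s => S.r s - lam * S.f s * (V x t - V (x + 1) t)) =
      fun s => S.r s - S.f s * (lam * (V x t - V (x + 1) t)) := by
    funext s; ring
  rw [this]

end IsValueFunction

lemma optimalRates_of_failed {lam : ℝ} {x : ℕ} (hx : S.xi ≤ x) (t : ℝ) :
    S.optimalRates lam x t = {0} := by
  unfold optimalRates
  rw [rates, if_neg (by omega)]
  ext s
  refine ⟨fun h => h.1, fun h => ⟨h, ?_⟩⟩
  rw [mem_singleton_iff.1 h, isMaxOn_iff]
  simp

lemma isGreatest_and_isLeast_optimalRates (S : ProductionSystem) (lam : ℝ) (x : ℕ) (t : ℝ) :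
    IsGreatest (S.optimalRates lam x t) (S.largestOptimalRate lam x t) ∧
      IsLeast (S.optimalRates lam x t) (S.smallestOptimalRate lam x t) := by
  have key : IsCompact (S.optimalRates lam x t) ∧ (S.optimalRates lam x t).Nonempty := by
    rcases lt_or_ge x S.xi with hx | hx
    · have : S.optimalRates lam x t = S.maximizers (lam * S.marginalValue lam x t) := by
        unfold optimalRates maximizers
        rw [rates, if_pos hx]
        simp only [mul_comm lam, mul_assoc]
      rw [this]
      exact ⟨S.isCompact_maximizers _, S.maximizers_nonempty _⟩
    · rw [optimalRates_of_failed hx]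
      exact ⟨isCompact_singleton, singleton_nonempty 0⟩
  exact ⟨key.1.isGreatest_sSup key.2, key.1.isLeast_sInf key.2⟩

lemma isAdmissible_feedback {lam : ℝ} {s : ℕ → ℝ → ℝ}
    (hs : ∀ y : ℕ, Measurable fun k : Set.Ici (0 : ℝ) => s y k)
    (hopt : ∀ y : ℕ, ∀ k : ℝ, 0 ≤ k → s y k ∈ S.optimalRates lam y k) (x : ℕ) (t : ℝ) :
    S.IsAdmissible x t (feedback x t s) where
  measurable n := by
    simp only [feedback, List.length_ofFn]
    have h1 : Measurable fun p : (Fin n → ℝ) × Icc (0 : ℝ) t =>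
        (⟨t - p.2, sub_nonneg.2 p.2.2.2⟩ : Set.Ici (0 : ℝ)) :=
      (measurable_const.sub (measurable_subtype_coe.comp measurable_snd)).subtype_mk
    exact (hs (x + n)).comp h1
  mem_rates h w hw := (hopt (x + h.length) (t - w) (by linarith [hw.2])).1

lemma isOptimalPolicy_feedback {lam : ℝ} (hlam : 0 ≤ lam) {s : ℕ → ℝ → ℝ}
    (hs : ∀ y : ℕ, Measurable fun k : Set.Ici (0 : ℝ) => s y k)
    (hopt : ∀ y : ℕ, ∀ k : ℝ, 0 ≤ k → s y k ∈ S.optimalRates lam y k) {x : ℕ} (hx : x ≤ S.xi)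
    {t : ℝ} (ht : 0 ≤ t) : S.IsOptimalPolicy lam x t (feedback x t s) := by
  obtain ⟨V, hV⟩ := S.exists_isValueFunction lam ht
  have hadm := isAdmissible_feedback hs hopt x t
  have htt : t ∈ Icc 0 t := ⟨ht, le_rfl⟩
  refine ⟨hadm, fun v hv => ?_⟩
  rw [(hV.expectedProfit_le_and_eq hlam hx htt hadm).2 fun h hh w hw => ?_]
  · exact (hV.expectedProfit_le_and_eq hlam hx htt hv).1
  · rw [← hV.optimalRates_eq hlam hh ⟨by linarith [hw.2], by linarith [hw.1]⟩]
    exact hopt (x + h.length) (t - w) (by linarith [hw.2])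

lemma strongSetLE_optimalRates {lam lam' : ℝ} (hlam : 0 ≤ lam) (hll : lam ≤ lam') {x x' : ℕ}
    (hxx : x ≤ x') (hx' : x' ≤ S.xi) {t t' : ℝ} (ht : 0 ≤ t) (htt : t ≤ t') :
    StrongSetLE (S.optimalRates lam' x' t') (S.optimalRates lam x t) := by
  rcases hx'.eq_or_lt with hx' | hx'
  · rw [optimalRates_of_failed hx'.ge]
    rintro _ rfl b hb
    have hb0 : 0 ≤ b := (rates_subset x hb.1).1
    rw [min_eq_left hb0, max_eq_right hb0]
    exact ⟨rfl, hb⟩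
  · obtain ⟨V, hV⟩ := S.exists_isValueFunction lam (ht.trans htt)
    obtain ⟨V', hV'⟩ := S.exists_isValueFunction lam' (ht.trans htt)
    have hx : x < S.xi := hxx.trans_lt hx'
    have hmt : t ∈ Icc 0 t' := ⟨ht, htt⟩
    have hmt' : t' ∈ Icc 0 t' := ⟨ht.trans htt, le_rfl⟩
    rw [hV.optimalRates_eq hlam hx hmt, hV'.optimalRates_eq (hlam.trans hll) hx' hmt']
    refine S.strongSetLE_maximizers ?_
    calc lam * (V x t - V (x + 1) t) ≤ lam * (V x t' - V (x + 1) t') :=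
          mul_le_mul_of_nonneg_left (hV.monotoneOn_sub hlam hx hmt hmt' htt) hlam
      _ ≤ lam * (V x' t' - V (x' + 1) t') :=
          mul_le_mul_of_nonneg_left (hV.sub_le_sub_succ hlam hxx hx' hmt') hlam
      _ ≤ lam' * (V' x' t' - V' (x' + 1) t') :=
          (hV.mul_sub_le_mul_sub hV' hlam hll (S.xi - x') x' (by omega) t' hmt').2 hx'

end ProductionSystem

end

theorem theorem1 (S : ProductionSystem) :
    -- in every state the optimal production rates have a largest and a smallest element
    (∀ lam : ℝ, 0 ≤ lam → ∀ x ≤ S.xi, ∀ t : ℝ, 0 ≤ t →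
      IsGreatest (S.optimalRates lam x t) (S.largestOptimalRate lam x t) ∧
      IsLeast (S.optimalRates lam x t) (S.smallestOptimalRate lam x t)) ∧
    -- using optimal production rates in all states is an optimal policy
    (∀ lam : ℝ, 0 ≤ lam → ∀ s : ℕ → ℝ → ℝ,
      (∀ y : ℕ, Measurable fun k : Set.Ici (0 : ℝ) => s y k) →
      (∀ y : ℕ, ∀ k : ℝ, 0 ≤ k → s y k ∈ S.optimalRates lam y k) →
      ∀ x ≤ S.xi, ∀ t : ℝ, 0 ≤ t →
        S.IsOptimalPolicy lam x t (ProductionSystem.feedback x t s)) ∧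
    -- monotonicity in the deterioration level, the time to maintenance and the base rate
    (∀ lam lam' : ℝ, 0 ≤ lam → lam ≤ lam' → ∀ x x' : ℕ, x ≤ x' → x' ≤ S.xi →
      ∀ t t' : ℝ, 0 ≤ t → t ≤ t' →
        StrongSetLE (S.optimalRates lam' x' t') (S.optimalRates lam x t) ∧
        S.largestOptimalRate lam' x' t' ≤ S.largestOptimalRate lam x t ∧
        S.smallestOptimalRate lam' x' t' ≤ S.smallestOptimalRate lam x t) := by
  refine ⟨fun lam _ x _ t _ => S.isGreatest_and_isLeast_optimalRates lam x t,
    fun lam hlam s hs hopt x hx t ht =>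
      ProductionSystem.isOptimalPolicy_feedback hlam hs hopt hx ht,
    fun lam lam' hlam hll x x' hxx hx' t t' ht htt => ?_⟩
  have h := ProductionSystem.strongSetLE_optimalRates (S := S) hlam hll hxx hx' ht htt
  have h1 := S.isGreatest_and_isLeast_optimalRates lam x t
  have h2 := S.isGreatest_and_isLeast_optimalRates lam' x' t'
  exact ⟨h, h.isGreatest_le h2.1 h1.1, h.isLeast_le h2.2 h1.2⟩
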